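/- Let $d\ge 1$ and $S=\mathbb R^d$. Let $\mathbb G_k=\{0,1\}^k$, $\mathbb T_k=\bigcup_{r\le k}\mathbb G_r$ and let $\mathbb T=\bigcup_{r\ge0}\mathbb G_r$ be the complete binary tree with root $\emptyset$. Let $\mathcal P$ be a probability kernel from $S$ to $S^2$ and $\nu$ a probability measure on $S$. Let $X=(X_u)_{u\in\mathbb T}$ be a bifurcating Markov chain with kernel $\mathcal P$ and initial law $\nu$, i.e. $X_\emptyset\sim\nu$ and, for all bounded measurable $g_i:S^3\to\mathbb R$ and all $k\ge 0$, $$\mathbb E\Big[\prod_{i\in\mathbb G_k}g_i(X_i,X_{i0},X_{i1})\,\Big|\,\sigma(X_j;j\in\mathbb T_k)\Big]=\prod_{i\in\mathbb G_k}\mathcal Pg_i(X_i)\ \text{ a.s.},\qquad \mathcal Pg(y)=\int g(y,z_0,z_1)\,\mathcal P(y,dz_0,dz_1).$$ Let $\mathcal Q=\frac12(P_0+P_1)$, where $P_0,P_1$ are the two marginal kernels of $\mathcal P$. Assume: 1. $F$ is a vector space of measurable functions $S\to\mathbb R$ that contains the constants, with $f^2\in F$ for $f\in F$, $F\subset L^1(\nu)$,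 and, for all $f,g\in F$, $f\otimes g\in L^1(\mathcal P(y,\cdot))$ for every $y\in S$ and $\mathcal P(f\otimes g)\in F$. 2. $\mu$ is a probability measure on $S$ such that $F\subset L^1(\mu)$ and, for every $f\in F$, $\mathcal Q^nf\to\langle\mu,f\rangle$ pointwise and there is $g\in F$ with $|\mathcal Q^nf|\le g$ for all $n\in\mathbb N$. Moreover there are $V:S\to[1,\infty)$ in $F$, $\alpha\in(0,1)$ and $M<\infty$ such that $|\mathcal Q^nf-\langle\mu,f\rangle|\le M\alpha^nV$ for all $n\in\mathbb N$ and all measurable $f$ with $|f|\le V$. 3. $\mathcal P$ has a (jointly measurable) density $\mathcal P(y,y_0,y_1)\ge0$ with respect to Lebesgue measure; write $\mathcal Q(y,y_0)=\frac12\int_S(\mathcal P(y,y_0,z)+\mathcal P(y,z,y_0))\,dz$ for the resulting density of $\mathcal Q$, and $\mu(y)\ge 0$ for a density of $\mu$. 4. $\sup_{y,y_0,y_1\in S}\big(\mu(y)+\mathcal Q(y,y_0)+\mathcal P(y,y_0,y_1)\big)<\infty$. 5. $h_n=2^{-n\gamma}$, where $0<\gamma<\frac1{3d}$ and $2\alpha^2<2^{3d\gamma}$.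 The kernel $K_0:S\to\mathbb R$ is measurable and bounded, $\int_SK_0=1$, and both $K_0$ and $K_0^2$ are integrable and square integrable. For a finite $A\subset\mathbb T$ and $h>0$ put $$\widehat\mu_{A,h}(x)=\frac1{|A|h^{d}}\sum_{u\in A}K_0\Big(\frac{x-X_u}{h}\Big),\qquad \widehat\mu^{\vartriangle}_{A,h}(x,x_0,x_1)=\frac1{|A|h^{3d}}\sum_{u\in A}K_0\Big(\frac{x-X_u}{h}\Big)K_0\Big(\frac{x_0-X_{u0}}{h}\Big)K_0\Big(\frac{x_1-X_{u1}}{h}\Big),$$ and, for $\mathbb A_n\in\{\mathbb G_n,\mathbb T_n\}$, put $\widehat{\mathcal P}_{\mathbb A_n}(x,x_0,x_1)=\widehat\mu^{\vartriangle}_{\mathbb A_n,h_n}(x,x_0,x_1)/\widehat\mu_{\mathbb A_n,h_n}(x)$, with the convention that it is $0$ when the denominator is $0$. Then, for every $(x,x_0,x_1)\in S^3$ such that $\mu(x)\ne0$, the density $\mu$ is continuous at $x$, and the density $\mu^{\vartriangle}(y,y_0,y_1)=\mu(y)\mathcal P(y,y_0,y_1)$ is continuous at $(x,x_0,x_1)$,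 one has, both for $\mathbb A_n=\mathbb G_n$ and for $\mathbb A_n=\mathbb T_n$, $$\widehat{\mathcal P}_{\mathbb A_n}(x,x_0,x_1)\longrightarrow\mathcal P(x,x_0,x_1)\quad\text{in probability as }n\to\infty .$$ -/

import Mathlib

open MeasureTheory ProbabilityTheory Filter Topology
open scoped ENNReal

noncomputable section

namespace BMC

/-- The state space `ℝ^d`, with its Borel `σ`-field and Lebesgue measure. -/
abbrev State (d : ℕ) : Type := EuclideanSpace ℝ (Fin d)

/-- The complete binary tree: finite words in `{0, 1}`. The root is the empty word. -/
abbrev Node : Type := List Bool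

/-- The first daughter `u0` of `u`. -/
def child0 (u : Node) : Node := u ++ [false]

/-- The second daughter `u1` of `u`. -/
def child1 (u : Node) : Node := u ++ [true]

/-- The `k`-th generation `𝔾_k = {0, 1}^k`. -/
def gen (k : ℕ) : Finset Node :=
  (Finset.univ : Finset (Fin k → Bool)).image List.ofFn

/-- The tree `𝕋_k` up to the `k`-th generation. -/
def tree (k : ℕ) : Finset Node := (Finset.range (k + 1)).biUnion gen

theorem mem_gen {k : ℕ} {u : Node} : u ∈ gen k ↔ u.length = k := by
  constructor
  · intro h
    obtain ⟨f, -, rfl⟩ := Finset.mem_image.1 h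
    simp
  · rintro rfl
    exact Finset.mem_image.2 ⟨u.get, Finset.mem_univ _, List.ofFn_get u⟩

theorem mem_tree {k : ℕ} {u : Node} : u ∈ tree k ↔ u.length ≤ k := by
  simp [tree, mem_gen]

variable {d : ℕ}

/-- `(P g)(x) = ∫ g(x, y, z) P(x, dy, dz)`. -/
def applyP (P : Kernel (State d) (State d × State d))
    (g : State d × State d × State d → ℝ) (x : State d) : ℝ :=
  ∫ y, g (x, y.1, y.2) ∂(P x)

/-- The mother-daughters triangle `(X_u, X_{u0}, X_{u1})`. -/
def triangle {Ω : Type*} (X : Node → Ω → State d) (u : Node) (ω : Ω) :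
    State d × State d × State d :=
  (X u ω, X (child0 u) ω, X (child1 u) ω)

/-- The process `X`, indexed by the binary tree, is a bifurcating Markov chain with initial
distribution `ν` and kernel `P`. -/
structure IsBMC {Ω : Type*} [MeasurableSpace Ω] (Pr : Measure Ω)
    (ν : Measure (State d)) (P : Kernel (State d) (State d × State d))
    (X : Node → Ω → State d) : Prop where
  measurable : ∀ u, Measurable (X u)
  initial : Measure.map (X []) Pr = ν
  branching : ∀ g : Node → State d × State d × State d → ℝ,
    (∀ i, Measurable (g i)) → (∀ i, ∃ C : ℝ, ∀ y, |g i y| ≤ C) →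
    ∀ k : ℕ,
      Pr[fun ω => ∏ i ∈ gen k, g i (triangle X i ω) |
          ⨆ j ∈ tree k, MeasurableSpace.comap (X j) inferInstance]
        =ᵐ[Pr] fun ω => ∏ i ∈ gen k, applyP P (g i) (X i ω)

/-- The kernel `Q = (P₀ + P₁) / 2`, where `P₀`, `P₁` are the two marginals of `P`. -/
def kernelQ (P : Kernel (State d) (State d × State d)) : Kernel (State d) (State d) where
  toFun x := (2⁻¹ : ℝ≥0∞) • (P.fst x + P.snd x)
  measurable' := by
    refine Measure.measurable_of_measurable_coe _ fun s hs => ?_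
    simp only [Measure.smul_apply, Measure.add_apply, smul_eq_mul]
    exact ((P.fst.measurable_coe hs).add (P.snd.measurable_coe hs)).const_mul _

/-- `(Q f)(x) = ∫ f(y) Q(x, dy)`; its `n`-th iterate `(applyQ P)^[n]` is the operator `Q^n`. -/
def applyQ (P : Kernel (State d) (State d × State d)) (f : State d → ℝ) (x : State d) : ℝ :=
  ∫ y, f y ∂(kernelQ P x)

/-- The structural assumption on the set `F` of real measurable functions. -/
structure StructuralAssumption (P : Kernel (State d) (State d × State d))
    (ν : Measure (State d)) (F : Submodule ℝ (State d → ℝ)) : Prop where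
  measurable : ∀ f ∈ F, Measurable f
  const_mem : ∀ c : ℝ, (fun _ => c) ∈ F
  sq_mem : ∀ f ∈ F, (fun x => f x ^ 2) ∈ F
  integrable_initial : ∀ f ∈ F, Integrable f ν
  integrable_tensor : ∀ f ∈ F, ∀ g ∈ F, ∀ x, Integrable (fun y => f y.1 * g y.2) (P x)
  tensor_mem : ∀ f ∈ F, ∀ g ∈ F, (fun x => ∫ y, f y.1 * g y.2 ∂(P x)) ∈ F

/-- The ergodicity assumption on `Q`, with limit `μ`, weight `V`, rate `α` and constant `M`. -/
structure ErgodicAssumption (P : Kernel (State d) (State d × State d))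
    (F : Submodule ℝ (State d → ℝ)) (μ : Measure (State d)) (V : State d → ℝ)
    (α M : ℝ) : Prop where
  integrable : ∀ f ∈ F, Integrable f μ
  tendsto : ∀ f ∈ F, ∀ x,
    Tendsto (fun n : ℕ => (applyQ P)^[n] f x) atTop (𝓝 (∫ y, f y ∂μ))
  dominated : ∀ f ∈ F, ∃ g ∈ F, ∀ (n : ℕ) (x), |(applyQ P)^[n] f x| ≤ g x
  one_le_weight : ∀ x, 1 ≤ V x
  weight_mem : V ∈ F
  rate_mem : α ∈ Set.Ioo (0 : ℝ) 1
  geometric : ∀ f : State d → ℝ, Measurable f → (∀ x, |f x| ≤ V x) →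
    ∀ (n : ℕ) (x), |(applyQ P)^[n] f x - ∫ y, f y ∂μ| ≤ M * α ^ n * V x

/-- The function `p` is a density of the kernel `P` with respect to Lebesgue measure. -/
structure IsTransitionDensity (P : Kernel (State d) (State d × State d))
    (p : State d → State d → State d → ℝ) : Prop where
  measurable : Measurable fun y : State d × State d × State d => p y.1 y.2.1 y.2.2
  nonneg : ∀ x x₀ x₁, 0 ≤ p x x₀ x₁
  eq_withDensity : ∀ x, P x =
    (volume : Measure (State d × State d)).withDensity
      fun y => ENNReal.ofReal (p x y.1 y.2)

/-- The function `m` is a density of the measure `μ` with respect to Lebesgue measure. -/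
structure IsLebesgueDensity (μ : Measure (State d)) (m : State d → ℝ) : Prop where
  measurable : Measurable m
  nonneg : ∀ x, 0 ≤ m x
  eq_withDensity : μ = (volume : Measure (State d)).withDensity fun y => ENNReal.ofReal (m y)

/-- The density `(1/2) ∫ (p(x, y, z) + p(x, z, y)) dz` of the kernel `Q`. -/
def densityQ (p : State d → State d → State d → ℝ) (x y : State d) : ℝ≥0∞ :=
  2⁻¹ * ∫⁻ z, (ENNReal.ofReal (p x y z) + ENNReal.ofReal (p x z y))

/-- The supremum over all `x, x₀, x₁` of `m(x) + Q(x, x₀) + p(x, x₀, x₁)`. -/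
def densityBound (m : State d → ℝ) (p : State d → State d → State d → ℝ) : ℝ≥0∞ :=
  ⨆ (x : State d) (x₀ : State d) (x₁ : State d),
    (ENNReal.ofReal (m x) + densityQ p x x₀ + ENNReal.ofReal (p x x₀ x₁))

/-- The smoothing kernel `K₀`: bounded, of integral one, and both `K₀` and `K₀²` are integrable
and square integrable. -/
structure IsSmoothingKernel (K₀ : State d → ℝ) : Prop where
  measurable : Measurable K₀
  integral_eq_one : ∫ y, K₀ y = 1
  bounded : ∃ C : ℝ, ∀ y, |K₀ y| ≤ C
  integrable : Integrable K₀
  integrable_sq : Integrable fun y => K₀ y ^ 2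
  integrable_sq_sq : Integrable fun y => (K₀ y ^ 2) ^ 2

/-- `K = K₀ ⊗ K₀ ⊗ K₀`. -/
def tensorKernel (K₀ : State d → ℝ) (y y₀ y₁ : State d) : ℝ := K₀ y * K₀ y₀ * K₀ y₁

/-- `K_{0h}(z) = h^{-d/2} K₀(h⁻¹ z)`. -/
def scaledKernel (K₀ : State d → ℝ) (h : ℝ) (z : State d) : ℝ :=
  h ^ (-((d : ℝ) / 2)) * K₀ (h⁻¹ • z)

/-- `K_h(z, z₀, z₁) = h^{-3d/2} K(h⁻¹ z, h⁻¹ z₀, h⁻¹ z₁)`. -/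
def scaledTensorKernel (K₀ : State d → ℝ) (h : ℝ) (z z₀ z₁ : State d) : ℝ :=
  h ^ (-(3 * (d : ℝ) / 2)) * tensorKernel K₀ (h⁻¹ • z) (h⁻¹ • z₀) (h⁻¹ • z₁)

/-- The kernel estimator of the density of `μ` at `x` from the individuals in `A`. -/
def muHat {Ω : Type*} (X : Node → Ω → State d) (K₀ : State d → ℝ) (A : Finset Node) (h : ℝ)
    (x : State d) (ω : Ω) : ℝ :=
  1 / ((A.card : ℝ) * h ^ ((d : ℝ) / 2)) * ∑ u ∈ A, scaledKernel K₀ h (x - X u ω)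

/-- The kernel estimator of the density of `μ(dx) P(x, dx₀, dx₁)` at `(x, x₀, x₁)`. -/
def muTriangleHat {Ω : Type*} (X : Node → Ω → State d) (K₀ : State d → ℝ) (A : Finset Node)
    (h : ℝ) (x x₀ x₁ : State d) (ω : Ω) : ℝ :=
  1 / ((A.card : ℝ) * h ^ (3 * (d : ℝ) / 2)) *
    ∑ u ∈ A, scaledTensorKernel K₀ h (x - X u ω) (x₀ - X (child0 u) ω) (x₁ - X (child1 u) ω)

/-- The quotient estimator of the transition density, equal to `0` where the denominator is. -/
def transitionHat {Ω : Type*} (X : Node → Ω → State d) (K₀ : State d → ℝ) (A : Finset Node)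
    (h : ℝ) (x x₀ x₁ : State d) (ω : Ω) : ℝ :=
  muTriangleHat X K₀ A h x x₀ x₁ ω / muHat X K₀ A h x ω

end BMC

end

/-!
The estimator is the quotient of two averages over the population, of the form
`|A|⁻¹ ∑ u ∈ A, f (X_u, X_{u0}, X_{u1})` with a function `f` rescaled with the bandwidth `h`.
Both averages are shown to converge in probability, the numerator to `m x * p x x₀ x₁` and the
denominator to `m x`. Division is continuous at a point with `m x ≠ 0`, which gives the theorem.

*Variance.* Given the generations up to `k`, the triangles of the generation `k` are independent,
so the second moment of their average is at most the second moment of the average of `P f`, plus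
`2⁻ᵏ` times the mean of the average of `P (f²)` (`IsBMC.integral_genAvg_triangle_sq_le`). Taking for
`f` the mean of `g` over the two daughters gives a recursion from the generation `k + 1` to the
generation `k`, in which `g` is replaced by `Q g` (`IsBMC.integral_genAvg_succ_sq_le`). If the
iterates `Qⁿ g` decay like `αⁿ V`, this recursion makes the second moments vanish
(`IsBMC.integral_genAvg_sq_le_genRate`); the means of the generation averages of `V²` that appear
on the way stay bounded because `V² ∈ F`.

The function `f` is of size `h⁻³ᵈ`, but `Q (P |f|)` is bounded uniformly in `h`, because the
densities of `P` and `Q` are bounded and the rescaled kernels have a fixed `L¹` norm. After two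
steps the centred function is therefore covered by the geometric ergodicity with constants that do not depend
on `h`, and the first two steps cost only `2⁻ᵏ h⁻³ᵈ`, as `f²` is at most `h⁻³ᵈ |f|` up to a constant
(`IsBMC.exists_integral_sq_sub_le`). Since `3 d γ < 1`, `2⁻ⁿ h⁻³ᵈ` tends to zero even after
multiplication by `n`. The average over the tree is a convex combination of averages over
generations, with weights of order `2ᵏ⁻ⁿ`, and inherits the bound
(`IsBMC.tendstoInMeasure_avg`).

*Bias.* The centring constant `∫ P f dμ` is the convolution of the density with a rescaled kernel
of integral one, and converges at continuity points by dominated convergence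
(`tendsto_integral_approximateIdentity`).
-/

namespace BMC

variable {d : ℕ}

/-! ### Bounded measurable functions and the operators `P` and `Q` -/

/-- Bounded measurable real functions. -/
structure IsBddMeasurable {E : Type*} [MeasurableSpace E] (f : E → ℝ) : Prop where
  measurable : Measurable f
  bounded : ∃ C : ℝ, ∀ y, |f y| ≤ C

namespace IsBddMeasurable

variable {E E' : Type*} [MeasurableSpace E] [MeasurableSpace E'] {f g : E → ℝ}

theorem const (c : ℝ) : IsBddMeasurable fun _ : E => c :=
  ⟨measurable_const, |c|, fun _ => le_rfl⟩

theorem add (hf : IsBddMeasurable f) (hg : IsBddMeasurable g) :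
    IsBddMeasurable fun y => f y + g y := by
  obtain ⟨A, hA⟩ := hf.bounded
  obtain ⟨B, hB⟩ := hg.bounded
  exact ⟨hf.measurable.add hg.measurable, A + B,
    fun y => (abs_add_le _ _).trans (add_le_add (hA y) (hB y))⟩

theorem mul (hf : IsBddMeasurable f) (hg : IsBddMeasurable g) :
    IsBddMeasurable fun y => f y * g y := by
  obtain ⟨A, hA⟩ := hf.bounded
  obtain ⟨B, hB⟩ := hg.bounded
  refine ⟨hf.measurable.mul hg.measurable, A * B, fun y => ?_⟩
  rw [abs_mul]
  exact mul_le_mul (hA y) (hB y) (abs_nonneg _) ((abs_nonneg _).trans (hA y))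

theorem const_mul (c : ℝ) (hf : IsBddMeasurable f) : IsBddMeasurable fun y => c * f y :=
  (const c).mul hf

theorem sub_const (hf : IsBddMeasurable f) (c : ℝ) : IsBddMeasurable fun y => f y - c := by
  simpa only [sub_eq_add_neg] using hf.add (const (-c))

theorem sq (hf : IsBddMeasurable f) : IsBddMeasurable fun y => f y ^ 2 := by
  simpa only [_root_.sq] using hf.mul hf

theorem abs (hf : IsBddMeasurable f) : IsBddMeasurable fun y => |f y| := by
  obtain ⟨A, hA⟩ := hf.bounded
  exact ⟨hf.measurable.abs, A, fun y => by rw [abs_abs]; exact hA y⟩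

theorem comp (hf : IsBddMeasurable f) {φ : E' → E} (hφ : Measurable φ) :
    IsBddMeasurable fun y => f (φ y) := by
  obtain ⟨A, hA⟩ := hf.bounded
  exact ⟨hf.measurable.comp hφ, A, fun y => hA _⟩

theorem sum {ι : Type*} (s : Finset ι) {F : ι → E → ℝ} (hF : ∀ i ∈ s, IsBddMeasurable (F i)) :
    IsBddMeasurable fun y => ∑ i ∈ s, F i y := by
  classical
  induction s using Finset.induction_on with
  | empty => simpa using const 0
  | insert a s ha ih =>
    simp only [Finset.sum_insert ha]
    exact (hF a (Finset.mem_insert_self a s)).add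
      (ih fun i hi => hF i (Finset.mem_insert_of_mem hi))

theorem integrable (hf : IsBddMeasurable f) (μ : Measure E) [IsFiniteMeasure μ] :
    Integrable f μ := by
  obtain ⟨A, hA⟩ := hf.bounded
  exact Integrable.of_bound hf.measurable.aestronglyMeasurable A (Eventually.of_forall hA)

end IsBddMeasurable

/-- A probability measure averages a function to at most any bound of the function. -/
theorem integral_le_of_le_const {E : Type*} [MeasurableSpace E] {μ : Measure E}
    [IsProbabilityMeasure μ] {f : E → ℝ} (hf : IsBddMeasurable f) {C : ℝ} (hC : ∀ y, f y ≤ C) :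
    ∫ y, f y ∂μ ≤ C := by
  simpa using integral_mono (hf.integrable μ) (integrable_const C) hC

theorem abs_integral_le_of_abs_le {E : Type*} [MeasurableSpace E] {μ : Measure E}
    [IsProbabilityMeasure μ] {f : E → ℝ} {C : ℝ} (hC : ∀ y, |f y| ≤ C) :
    |∫ y, f y ∂μ| ≤ C := by
  simpa using norm_integral_le_of_norm_le_const (μ := μ)
    (Eventually.of_forall hC : ∀ᵐ y ∂μ, ‖f y‖ ≤ C)

theorem sq_integral_le {E : Type*} [MeasurableSpace E] {μ : Measure E}
    [IsProbabilityMeasure μ] {f : E → ℝ} (hf : IsBddMeasurable f) :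
    (∫ y, f y ∂μ) ^ 2 ≤ ∫ y, f y ^ 2 ∂μ := by
  have h := ConvexOn.map_integral_le (μ := μ) (f := f) (even_two.convexOn_pow (𝕜 := ℝ))
    (continuous_pow 2).continuousOn isClosed_univ (by simp) (hf.integrable μ)
    (hf.sq.integrable μ)
  simpa using h

theorem IsBddMeasurable.daughters_avg {g : State d → ℝ} (hg : IsBddMeasurable g) :
    IsBddMeasurable fun y : State d × State d × State d => 2⁻¹ * (g y.2.1 + g y.2.2) :=
  ((hg.comp (φ := fun y : State d × State d × State d => y.2.1) (by fun_prop)).add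
    (hg.comp (φ := fun y : State d × State d × State d => y.2.2) (by fun_prop))).const_mul _

section Operators

variable {P : Kernel (State d) (State d × State d)}

theorem applyQ_const_mul (c : ℝ) (f : State d → ℝ) :
    applyQ P (fun y => c * f y) = fun x => c * applyQ P f x := by
  funext x; exact integral_const_mul _ _

theorem applyQ_iterate_const_mul (c : ℝ) (f : State d → ℝ) (n : ℕ) :
    (applyQ P)^[n] (fun y => c * f y) = fun x => c * (applyQ P)^[n] f x := by
  induction n with
  | zero => rfl
  | succ n ih => simp only [Function.iterate_succ_apply', ih]; exact applyQ_const_mul _ _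

theorem applyQ_mono {f g : State d → ℝ} {x : State d} (hf : Integrable f (kernelQ P x))
    (hg : Integrable g (kernelQ P x)) (h : ∀ y, f y ≤ g y) : applyQ P f x ≤ applyQ P g x :=
  integral_mono hf hg h

theorem integrable_kernelQ {f : State d → ℝ} {x : State d} (hf : Measurable f)
    (h0 : Integrable (fun y => f y.1) (P x)) (h1 : Integrable (fun y => f y.2) (P x)) :
    Integrable f (kernelQ P x) := by
  refine Integrable.smul_measure (Integrable.add_measure ?_ ?_) (by simp)
  · rw [Kernel.fst_apply]
    exact (integrable_map_measure hf.aestronglyMeasurable measurable_fst.aemeasurable).2 h0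
  · rw [Kernel.snd_apply]
    exact (integrable_map_measure hf.aestronglyMeasurable measurable_snd.aemeasurable).2 h1

theorem applyQ_eq {f : State d → ℝ} {x : State d} (hf : Measurable f)
    (h0 : Integrable (fun y => f y.1) (P x)) (h1 : Integrable (fun y => f y.2) (P x)) :
    applyQ P f x = 2⁻¹ * (∫ y, f y.1 ∂(P x) + ∫ y, f y.2 ∂(P x)) := by
  have e0 : Integrable f (P.fst x) := by
    rw [Kernel.fst_apply]
    exact (integrable_map_measure hf.aestronglyMeasurable measurable_fst.aemeasurable).2 h0
  have e1 : Integrable f (P.snd x) := by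
    rw [Kernel.snd_apply]
    exact (integrable_map_measure hf.aestronglyMeasurable measurable_snd.aemeasurable).2 h1
  change ∫ y, f y ∂((2⁻¹ : ℝ≥0∞) • (P.fst x + P.snd x)) = _
  rw [integral_smul_measure, integral_add_measure e0 e1, Kernel.fst_apply, Kernel.snd_apply,
    integral_map measurable_fst.aemeasurable hf.aestronglyMeasurable,
    integral_map measurable_snd.aemeasurable hf.aestronglyMeasurable]
  simp

instance [IsMarkovKernel P] : IsMarkovKernel (kernelQ P) := by
  refine ⟨fun x => ⟨?_⟩⟩
  change ((2⁻¹ : ℝ≥0∞) • (P.fst x + P.snd x)) Set.univ = 1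
  simp only [Measure.smul_apply, Measure.add_apply, measure_univ, smul_eq_mul]
  rw [one_add_one_eq_two]
  exact ENNReal.inv_mul_cancel two_ne_zero ENNReal.ofNat_ne_top

variable [IsMarkovKernel P]

theorem IsBddMeasurable.applyP {f : State d × State d × State d → ℝ} (hf : IsBddMeasurable f) :
    IsBddMeasurable (applyP P f) := by
  obtain ⟨A, hA⟩ := hf.bounded
  exact ⟨(StronglyMeasurable.integral_kernel_prod_right' (κ := P)
    hf.measurable.stronglyMeasurable).measurable, A,
    fun _ => abs_integral_le_of_abs_le fun _ => hA _⟩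

theorem IsBddMeasurable.applyQ {f : State d → ℝ} (hf : IsBddMeasurable f) :
    IsBddMeasurable (applyQ P f) := by
  obtain ⟨A, hA⟩ := hf.bounded
  exact ⟨(StronglyMeasurable.integral_kernel (κ := kernelQ P)
    hf.measurable.stronglyMeasurable).measurable, A,
    fun _ => abs_integral_le_of_abs_le fun _ => hA _⟩

theorem IsBddMeasurable.applyQ_iterate {f : State d → ℝ} (hf : IsBddMeasurable f) (n : ℕ) :
    IsBddMeasurable ((BMC.applyQ P)^[n] f) := by
  induction n with
  | zero => exact hf
  | succ n ih => rw [Function.iterate_succ_apply']; exact ih.applyQ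

theorem applyP_const (c : ℝ) : applyP P (fun _ => c) = fun _ => c := by
  funext x; simp [applyP]

theorem applyP_sub_const {f : State d × State d × State d → ℝ} (hf : IsBddMeasurable f) (c : ℝ) :
    applyP P (fun y => f y - c) = fun x => applyP P f x - c := by
  funext x
  have h : IsBddMeasurable fun y : State d × State d => f (x, y.1, y.2) :=
    hf.comp (φ := fun y : State d × State d => (x, y.1, y.2)) (by fun_prop)
  simp only [applyP]
  rw [integral_sub (h.integrable _) (integrable_const c)]
  simp

theorem applyP_mono {f g : State d × State d × State d → ℝ} (hf : IsBddMeasurable f)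
    (hg : IsBddMeasurable g) (h : ∀ y, f y ≤ g y) (x : State d) : applyP P f x ≤ applyP P g x :=
  integral_mono
    ((hf.comp (φ := fun y : State d × State d => (x, y.1, y.2)) (by fun_prop)).integrable _)
    ((hg.comp (φ := fun y : State d × State d => (x, y.1, y.2)) (by fun_prop)).integrable _)
    fun _ => h _

theorem sq_applyP_le {f : State d × State d × State d → ℝ} (hf : IsBddMeasurable f)
    (x : State d) : applyP P f x ^ 2 ≤ applyP P (fun y => f y ^ 2) x :=
  sq_integral_le
    (hf.comp (φ := fun y : State d × State d => (x, y.1, y.2)) (by fun_prop))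

theorem applyQ_sub_const {f : State d → ℝ} (hf : IsBddMeasurable f) (c : ℝ) :
    applyQ P (fun y => f y - c) = fun x => applyQ P f x - c := by
  funext x
  simp only [applyQ]
  rw [integral_sub (hf.integrable _) (integrable_const c)]
  simp

/-- `Q g` is `P` applied to the average of `g` over the two daughters. -/
theorem applyP_daughters_avg {g : State d → ℝ} (hg : IsBddMeasurable g) :
    applyP P (fun y => 2⁻¹ * (g y.2.1 + g y.2.2)) = applyQ P g := by
  funext x
  have h0 := (hg.comp (E' := State d × State d) measurable_fst).integrable (P x)
  have h1 := (hg.comp (E' := State d × State d) measurable_snd).integrable (P x)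
  rw [applyQ_eq hg.measurable h0 h1, applyP, integral_const_mul, integral_add h0 h1]

end Operators

/-! ### Averages over a generation -/

/-- The average over the `k`-th generation of a function of the nodes. -/
noncomputable def genAvg (Y : Node → ℝ) (k : ℕ) : ℝ := (2 ^ k : ℝ)⁻¹ * ∑ u ∈ gen k, Y u

theorem card_gen (k : ℕ) : (gen k).card = 2 ^ k := by
  rw [gen, Finset.card_image_of_injective _ List.ofFn_injective]
  simp

theorem genAvg_sub_const (Y : Node → ℝ) (c : ℝ) (k : ℕ) :
    genAvg (fun u => Y u - c) k = genAvg Y k - c := by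
  simp only [genAvg, Finset.sum_sub_distrib, Finset.sum_const, card_gen, nsmul_eq_mul]
  push_cast
  field_simp

theorem genAvg_mono {Y Z : Node → ℝ} (h : ∀ u, Y u ≤ Z u) (k : ℕ) : genAvg Y k ≤ genAvg Z k :=
  mul_le_mul_of_nonneg_left (Finset.sum_le_sum fun u _ => h u) (by positivity)

theorem genAvg_const (c : ℝ) (k : ℕ) : genAvg (fun _ => c) k = c := by
  simp [genAvg, card_gen]

theorem genAvg_const_mul (c : ℝ) (Y : Node → ℝ) (k : ℕ) :
    genAvg (fun u => c * Y u) k = c * genAvg Y k := by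
  simp only [genAvg, ← Finset.mul_sum]; ring

theorem genAvg_zero (Y : Node → ℝ) : genAvg Y 0 = Y [] := by
  have : gen 0 = {[]} := by
    ext u; simp [mem_gen]
  simp [genAvg, this]

/-- The generation `k + 1` consists of the daughters of the generation `k`. -/
theorem sum_gen_succ (Y : Node → ℝ) (k : ℕ) :
    ∑ v ∈ gen (k + 1), Y v = ∑ u ∈ gen k, (Y (child0 u) + Y (child1 u)) := by
  have h : ∑ u ∈ gen k, (Y (child0 u) + Y (child1 u)) =
      ∑ q ∈ gen k ×ˢ (Finset.univ : Finset Bool), Y (q.1 ++ [q.2]) := by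
    rw [Finset.sum_product]
    refine Finset.sum_congr rfl fun u _ => ?_
    simp [child0, child1, add_comm]
  rw [h]
  symm
  refine Finset.sum_bij (fun q _ => q.1 ++ [q.2]) ?_ ?_ ?_ fun _ _ => rfl
  · rintro ⟨u, b⟩ hq
    simp only [Finset.mem_product, mem_gen] at hq ⊢
    simp [hq.1]
  · rintro ⟨u, b⟩ _ ⟨v, c⟩ _ heq
    simpa using List.append_inj' heq rfl
  · intro v hv
    rw [mem_gen] at hv
    have hne : v ≠ [] := by rintro rfl; simp at hv
    refine ⟨(v.dropLast, v.getLast hne), ?_, List.dropLast_append_getLast hne⟩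
    simp [mem_gen, hv]

theorem genAvg_succ (Y : Node → ℝ) (k : ℕ) :
    genAvg Y (k + 1) = genAvg (fun u => 2⁻¹ * (Y (child0 u) + Y (child1 u))) k := by
  simp only [genAvg, sum_gen_succ, ← Finset.mul_sum, pow_succ, mul_inv]
  ring

/-! ### Moments of generation averages -/

section Moments

variable {Ω : Type*} [MeasurableSpace Ω] {Pr : Measure Ω} {ν : Measure (State d)}
  {P : Kernel (State d) (State d × State d)} {X : Node → Ω → State d}

theorem IsBMC.measurable_triangle (hX : IsBMC Pr ν P X) (u : Node) :
    Measurable (triangle X u) :=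
  (hX.measurable _).prodMk ((hX.measurable _).prodMk (hX.measurable _))

theorem isBddMeasurable_genAvg {Y : Node → Ω → ℝ} (hY : ∀ u, IsBddMeasurable (Y u)) (k : ℕ) :
    IsBddMeasurable fun ω => genAvg (fun u => Y u ω) k :=
  (IsBddMeasurable.sum _ fun u _ => hY u).const_mul _

variable [IsProbabilityMeasure Pr]

/-- Conditionally on the generations up to `k`, the triangles of the generation `k` are drawn
from `P`. -/
theorem IsBMC.integral_prod_triangle (hX : IsBMC Pr ν P X)
    {g : Node → State d × State d × State d → ℝ} (hg : ∀ i, IsBddMeasurable (g i)) (k : ℕ) :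
    ∫ ω, ∏ i ∈ gen k, g i (triangle X i ω) ∂Pr =
      ∫ ω, ∏ i ∈ gen k, applyP P (g i) (X i ω) ∂Pr := by
  have hle : (⨆ j ∈ tree k, MeasurableSpace.comap (X j) inferInstance) ≤ ‹MeasurableSpace Ω› :=
    iSup₂_le fun j _ => (hX.measurable j).comap_le
  rw [← integral_condExp hle]
  exact integral_congr_ae (hX.branching g (fun i => (hg i).measurable) (fun i => (hg i).bounded) k)

theorem IsBMC.integral_genAvg_le (hX : IsBMC Pr ν P X) {g : State d → ℝ}
    (hg : IsBddMeasurable g) {C : ℝ} (hC : ∀ x, g x ≤ C) (k : ℕ) :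
    ∫ ω, genAvg (fun u => g (X u ω)) k ∂Pr ≤ C :=
  integral_le_of_le_const (isBddMeasurable_genAvg (fun u => hg.comp (hX.measurable u)) k)
    fun _ => (genAvg_mono (fun _ => hC _) k).trans_eq (genAvg_const C k)

variable [IsMarkovKernel P]

theorem IsBMC.integral_triangle (hX : IsBMC Pr ν P X) {f : State d × State d × State d → ℝ}
    (hf : IsBddMeasurable f) (u : Node) :
    ∫ ω, f (triangle X u ω) ∂Pr = ∫ ω, applyP P f (X u ω) ∂Pr := by
  classical
  have h := hX.integral_prod_triangle (g := fun i => if i = u then f else fun _ => 1)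
    (fun i => by split_ifs; exacts [hf, .const 1]) u.length
  have hu : u ∈ gen u.length := mem_gen.2 rfl
  have e1 : ∀ ω, ∏ i ∈ gen u.length, (if i = u then f else fun _ => (1 : ℝ)) (triangle X i ω) =
      f (triangle X u ω) := fun ω => by
    rw [Finset.prod_eq_single_of_mem u hu (fun i _ hi => by simp [hi])]; simp
  have e2 : ∀ ω, ∏ i ∈ gen u.length, applyP P (if i = u then f else fun _ => (1 : ℝ)) (X i ω) =
      applyP P f (X u ω) := fun ω => by
    rw [Finset.prod_eq_single_of_mem u hu (fun i _ hi => by simp [hi, applyP_const])]; simp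
  simpa only [e1, e2] using h

/-- Distinct triangles of one generation are conditionally independent. -/
theorem IsBMC.integral_triangle_mul_triangle (hX : IsBMC Pr ν P X)
    {f : State d × State d × State d → ℝ} (hf : IsBddMeasurable f) {k : ℕ} {u v : Node}
    (hu : u ∈ gen k) (hv : v ∈ gen k) (huv : u ≠ v) :
    ∫ ω, f (triangle X u ω) * f (triangle X v ω) ∂Pr =
      ∫ ω, applyP P f (X u ω) * applyP P f (X v ω) ∂Pr := by
  classical
  have h := hX.integral_prod_triangle (g := fun i => if i = u ∨ i = v then f else fun _ => 1)
    (fun i => by split_ifs; exacts [hf, .const 1]) k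
  have e1 : ∀ ω, ∏ i ∈ gen k,
      (if i = u ∨ i = v then f else fun _ => (1 : ℝ)) (triangle X i ω) =
      f (triangle X u ω) * f (triangle X v ω) := fun ω => by
    rw [Finset.prod_eq_mul_of_mem u v hu hv huv (fun i _ hi => by simp [hi.1, hi.2])]; simp
  have e2 : ∀ ω, ∏ i ∈ gen k,
      applyP P (if i = u ∨ i = v then f else fun _ => (1 : ℝ)) (X i ω) =
      applyP P f (X u ω) * applyP P f (X v ω) := fun ω => by
    rw [Finset.prod_eq_mul_of_mem u v hu hv huv
      (fun i _ hi => by simp [hi.1, hi.2, applyP_const])]; simp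
  simpa only [e1, e2] using h

theorem IsBMC.integral_genAvg_triangle (hX : IsBMC Pr ν P X)
    {f : State d × State d × State d → ℝ} (hf : IsBddMeasurable f) (k : ℕ) :
    ∫ ω, genAvg (fun u => f (triangle X u ω)) k ∂Pr =
      ∫ ω, genAvg (fun u => applyP P f (X u ω)) k ∂Pr := by
  simp only [genAvg, integral_const_mul]
  rw [integral_finsetSum _ fun u _ => (hf.comp (hX.measurable_triangle u)).integrable Pr,
    integral_finsetSum _ fun u _ => (hf.applyP.comp (hX.measurable u)).integrable Pr]
  simp only [hX.integral_triangle hf]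

/-- Conditionally on the generations up to `k`, the second moment of the average of `f` over the
triangles of the generation `k` is the square of the average of `P f`, plus a conditional variance
to which only the diagonal terms contribute. -/
theorem IsBMC.integral_genAvg_triangle_sq_le (hX : IsBMC Pr ν P X)
    {f : State d × State d × State d → ℝ} (hf : IsBddMeasurable f) (k : ℕ) :
    ∫ ω, genAvg (fun u => f (triangle X u ω)) k ^ 2 ∂Pr ≤
      ∫ ω, genAvg (fun u => applyP P f (X u ω)) k ^ 2 ∂Pr +
        (2 ^ k : ℝ)⁻¹ * ∫ ω, genAvg (fun u => applyP P (fun y => f y ^ 2) (X u ω)) k ∂Pr := by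
  classical
  have hT : ∀ u, IsBddMeasurable fun ω => f (triangle X u ω) :=
    fun u => hf.comp (hX.measurable_triangle u)
  have hS : ∀ u, IsBddMeasurable fun ω => applyP P f (X u ω) :=
    fun u => hf.applyP.comp (hX.measurable u)
  have hD : ∀ u, IsBddMeasurable fun ω => applyP P (fun y => f y ^ 2) (X u ω) :=
    fun u => hf.sq.applyP.comp (hX.measurable u)
  have expand : ∀ Y : Node → Ω → ℝ, (∀ u, IsBddMeasurable (Y u)) →
      ∫ ω, (∑ u ∈ gen k, Y u ω) ^ 2 ∂Pr =
        ∑ u ∈ gen k, ∑ v ∈ gen k, ∫ ω, Y u ω * Y v ω ∂Pr := by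
    intro Y hY
    simp only [sq, Finset.sum_mul_sum]
    rw [integral_finsetSum _ fun u _ =>
      (IsBddMeasurable.sum _ fun v _ => (hY u).mul (hY v)).integrable Pr]
    exact Finset.sum_congr rfl fun u _ =>
      integral_finsetSum _ fun v _ => ((hY u).mul (hY v)).integrable Pr
  have key : ∫ ω, (∑ u ∈ gen k, f (triangle X u ω)) ^ 2 ∂Pr ≤
      ∫ ω, (∑ u ∈ gen k, applyP P f (X u ω)) ^ 2 ∂Pr +
        ∫ ω, ∑ u ∈ gen k, applyP P (fun y => f y ^ 2) (X u ω) ∂Pr := by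
    rw [expand _ hT, expand _ hS, integral_finsetSum _ fun u _ => (hD u).integrable Pr,
      ← Finset.sum_add_distrib]
    refine Finset.sum_le_sum fun u hu => ?_
    rw [← Finset.add_sum_erase _ _ hu, ← Finset.add_sum_erase _ _ hu]
    have h1 : ∫ ω, f (triangle X u ω) * f (triangle X u ω) ∂Pr =
        ∫ ω, applyP P (fun y => f y ^ 2) (X u ω) ∂Pr := by
      rw [← hX.integral_triangle hf.sq]; simp only [sq]
    have h2 : ∑ v ∈ (gen k).erase u, ∫ ω, f (triangle X u ω) * f (triangle X v ω) ∂Pr =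
        ∑ v ∈ (gen k).erase u, ∫ ω, applyP P f (X u ω) * applyP P f (X v ω) ∂Pr :=
      Finset.sum_congr rfl fun v hv => hX.integral_triangle_mul_triangle hf hu
        (Finset.mem_of_mem_erase hv) (Finset.ne_of_mem_erase hv).symm
    have h3 : 0 ≤ ∫ ω, applyP P f (X u ω) * applyP P f (X u ω) ∂Pr :=
      integral_nonneg fun ω => mul_self_nonneg _
    rw [h1, h2]
    linarith
  simp only [genAvg, mul_pow, integral_const_mul]
  have := mul_le_mul_of_nonneg_left key (by positivity : (0 : ℝ) ≤ ((2 ^ k : ℝ)⁻¹) ^ 2)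
  calc _ ≤ _ := this
    _ = _ := by ring

/-- The first moment obeys the recursion of the auxiliary Markov chain with kernel `Q`. -/
theorem IsBMC.integral_genAvg_succ (hX : IsBMC Pr ν P X) {g : State d → ℝ}
    (hg : IsBddMeasurable g) (k : ℕ) :
    ∫ ω, genAvg (fun u => g (X u ω)) (k + 1) ∂Pr =
      ∫ ω, genAvg (fun u => applyQ P g (X u ω)) k ∂Pr := by
  have h := hX.integral_genAvg_triangle hg.daughters_avg k
  rw [applyP_daughters_avg hg] at h
  rw [← h]
  simp only [genAvg_succ, triangle]

theorem IsBMC.integral_genAvg_succ_sq_le (hX : IsBMC Pr ν P X) {g : State d → ℝ}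
    (hg : IsBddMeasurable g) (k : ℕ) :
    ∫ ω, genAvg (fun u => g (X u ω)) (k + 1) ^ 2 ∂Pr ≤
      ∫ ω, genAvg (fun u => applyQ P g (X u ω)) k ^ 2 ∂Pr +
        (2 ^ k : ℝ)⁻¹ * ∫ ω, genAvg (fun u => applyQ P (fun y => g y ^ 2) (X u ω)) k ∂Pr := by
  have hf := hg.daughters_avg
  have h := hX.integral_genAvg_triangle_sq_le hf k
  rw [applyP_daughters_avg hg] at h
  simp only [genAvg_succ]
  refine h.trans ?_
  gcongr
  · exact (isBddMeasurable_genAvg (fun u => hf.sq.applyP.comp (hX.measurable u)) k).integrable Pr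
  · exact (isBddMeasurable_genAvg (fun u => hg.sq.applyQ.comp (hX.measurable u)) k).integrable Pr
  intro ω
  refine genAvg_mono (fun u => ?_) k
  rw [← applyP_daughters_avg hg.sq]
  refine applyP_mono hf.sq hg.sq.daughters_avg (fun y => ?_) _
  nlinarith [sq_nonneg (g y.2.1 - g y.2.2)]

theorem IsBMC.integral_genAvg (hX : IsBMC Pr ν P X) {g : State d → ℝ}
    (hg : IsBddMeasurable g) (k : ℕ) :
    ∫ ω, genAvg (fun u => g (X u ω)) k ∂Pr = ∫ x, (applyQ P)^[k] g x ∂ν := by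
  induction k generalizing g with
  | zero =>
    simp only [genAvg_zero, Function.iterate_zero, id]
    rw [← hX.initial, integral_map (hX.measurable []).aemeasurable
      hg.measurable.aestronglyMeasurable]
  | succ k ih => rw [hX.integral_genAvg_succ hg, ih hg.applyQ, Function.iterate_succ_apply]

end Moments

/-! ### Consequences of ergodicity -/

section Ergodic

variable {P : Kernel (State d) (State d × State d)} {ν μ : Measure (State d)}
  {F : Submodule ℝ (State d → ℝ)} {V : State d → ℝ} {α M : ℝ}

theorem StructuralAssumption.integrable_fst (hF : StructuralAssumption P ν F) {f : State d → ℝ}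
    (hf : f ∈ F) (x : State d) : Integrable (fun y => f y.1) (P x) := by
  simpa using hF.integrable_tensor f hf _ (hF.const_mem 1) x

theorem StructuralAssumption.integrable_snd (hF : StructuralAssumption P ν F) {f : State d → ℝ}
    (hf : f ∈ F) (x : State d) : Integrable (fun y => f y.2) (P x) := by
  simpa using hF.integrable_tensor _ (hF.const_mem 1) f hf x

theorem StructuralAssumption.integrable_kernelQ (hF : StructuralAssumption P ν F)
    {f : State d → ℝ} (hf : f ∈ F) (x : State d) : Integrable f (kernelQ P x) :=
  BMC.integrable_kernelQ (hF.measurable f hf) (hF.integrable_fst hf x) (hF.integrable_snd hf x)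

theorem StructuralAssumption.applyQ_mem (hF : StructuralAssumption P ν F) {f : State d → ℝ}
    (hf : f ∈ F) : applyQ P f ∈ F := by
  have h0 := hF.tensor_mem f hf _ (hF.const_mem 1)
  have h1 := hF.tensor_mem _ (hF.const_mem 1) f hf
  have h := F.smul_mem (2⁻¹ : ℝ) (F.add_mem h0 h1)
  convert h using 1
  funext x
  simp [applyQ_eq (hF.measurable f hf) (hF.integrable_fst hf x) (hF.integrable_snd hf x)]

theorem StructuralAssumption.applyQ_iterate_mem (hF : StructuralAssumption P ν F)
    {f : State d → ℝ} (hf : f ∈ F) (n : ℕ) : (applyQ P)^[n] f ∈ F := by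
  induction n with
  | zero => exact hf
  | succ n ih => rw [Function.iterate_succ_apply']; exact hF.applyQ_mem ih

theorem ErgodicAssumption.const_nonneg (hE : ErgodicAssumption P F μ V α M) : 0 ≤ M := by
  have h := hE.geometric (fun _ => 0) measurable_const
    (fun x => by simpa using zero_le_one.trans (hE.one_le_weight x)) 0 0
  have hV := hE.one_le_weight 0
  have h' := (abs_nonneg _).trans h
  rw [pow_zero, mul_one] at h'
  by_contra! hM
  nlinarith

/-- A bounded function lies below a multiple of the weight, so its iterates converge
geometrically. -/
theorem ErgodicAssumption.abs_iterate_sub_le (hE : ErgodicAssumption P F μ V α M)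
    {g : State d → ℝ} (hg : Measurable g) {C : ℝ} (hC : 0 < C) (hgC : ∀ x, |g x| ≤ C)
    (n : ℕ) (x : State d) :
    |(applyQ P)^[n] g x - ∫ y, g y ∂μ| ≤ C * M * α ^ n * V x := by
  have h := hE.geometric (fun y => C⁻¹ * g y) (hg.const_mul _) (fun y => by
    rw [abs_mul, abs_of_pos (inv_pos.2 hC), inv_mul_le_iff₀ hC]
    exact (hgC y).trans (le_mul_of_one_le_right hC.le (hE.one_le_weight y))) n x
  rw [applyQ_iterate_const_mul, integral_const_mul, ← mul_sub, abs_mul,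
    abs_of_pos (inv_pos.2 hC), inv_mul_le_iff₀ hC] at h
  linarith

theorem ErgodicAssumption.tendsto_iterate (hE : ErgodicAssumption P F μ V α M)
    {g : State d → ℝ} (hg : IsBddMeasurable g) (x : State d) :
    Tendsto (fun n => (applyQ P)^[n] g x) atTop (𝓝 (∫ y, g y ∂μ)) := by
  obtain ⟨C, hC⟩ := hg.bounded
  have hlim : Tendsto (fun n : ℕ => (|C| + 1) * M * α ^ n * V x) atTop (𝓝 0) := by
    simpa using ((tendsto_pow_atTop_nhds_zero_of_lt_one hE.rate_mem.1.le hE.rate_mem.2).const_mul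
      ((|C| + 1) * M)).mul_const (V x)
  refine tendsto_iff_norm_sub_tendsto_zero.2
    (squeeze_zero (fun _ => norm_nonneg _) (fun n => ?_) hlim)
  exact hE.abs_iterate_sub_le hg.measurable (by positivity)
    (fun y => ((hC y).trans (le_abs_self C)).trans (by linarith)) n x

variable [IsMarkovKernel P]

/-- The limit measure is invariant under `Q`, being the limit of the iterates of `Q`. -/
theorem ErgodicAssumption.integral_applyQ (hE : ErgodicAssumption P F μ V α M)
    {g : State d → ℝ} (hg : IsBddMeasurable g) :
    ∫ y, applyQ P g y ∂μ = ∫ y, g y ∂μ := by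
  refine tendsto_nhds_unique (hE.tendsto_iterate hg.applyQ 0) ?_
  simpa only [← Function.iterate_succ_apply] using
    (tendsto_add_atTop_iff_nat 1).2 (hE.tendsto_iterate hg 0)

end Ergodic

/-! ### Second moments of centred averages -/

/-- A nonnegative sequence that contracts up to a vanishing error tends to zero. -/
theorem tendsto_zero_of_le_mul_add {a b : ℕ → ℝ} {r : ℝ} (hr : 0 ≤ r) (hr1 : r < 1)
    (ha : ∀ n, 0 ≤ a n) (hab : ∀ n, a (n + 1) ≤ r * a n + b n) (hb : Tendsto b atTop (𝓝 0)) :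
    Tendsto a atTop (𝓝 0) := by
  rw [Metric.tendsto_atTop]
  intro ε hε
  obtain ⟨N, hN⟩ := eventually_atTop.1
    (hb.eventually (gt_mem_nhds (show 0 < (1 - r) * (ε / 2) by nlinarith)))
  have key : ∀ k, a (N + k) ≤ ε / 2 + r ^ k * a N := by
    intro k
    induction k with
    | zero => simp; linarith
    | succ k ih =>
      have h1 := hab (N + k)
      have h2 := hN (N + k) (by omega)
      have h3 := mul_le_mul_of_nonneg_left ih hr
      rw [← add_assoc, pow_succ]
      linarith
  have hlim : Tendsto (fun k : ℕ => r ^ k * a N) atTop (𝓝 0) := by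
    simpa using (tendsto_pow_atTop_nhds_zero_of_lt_one hr hr1).mul_const (a N)
  obtain ⟨K, hK⟩ := eventually_atTop.1 (hlim.eventually (gt_mem_nhds (half_pos hε)))
  refine ⟨N + K, fun n hn => ?_⟩
  obtain ⟨k, rfl⟩ := Nat.exists_eq_add_of_le hn
  have h1 := key (K + k)
  have h2 := hK (K + k) (by omega)
  rw [Real.dist_eq, sub_zero, abs_of_nonneg (ha _), add_assoc]
  linarith

/-- The rate at which the second moment of the average over the `k`-th generation of a function
with geometrically decaying iterates vanishes. -/
noncomputable def genRate (α : ℝ) : ℕ → ℝ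
  | 0 => 1
  | k + 1 => α ^ 2 * genRate α k + (2 ^ k : ℝ)⁻¹

theorem genRate_nonneg (α : ℝ) (k : ℕ) : 0 ≤ genRate α k := by
  induction k with
  | zero => exact zero_le_one
  | succ k ih => rw [genRate]; positivity

theorem tendsto_inv_two_pow : Tendsto (fun k : ℕ => (2 ^ k : ℝ)⁻¹) atTop (𝓝 0) := by
  simpa only [inv_pow] using
    tendsto_pow_atTop_nhds_zero_of_lt_one (r := (2⁻¹ : ℝ)) (by norm_num) (by norm_num)

theorem tendsto_genRate {α : ℝ} (hα : α ∈ Set.Ioo (0 : ℝ) 1) :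
    Tendsto (genRate α) atTop (𝓝 0) :=
  tendsto_zero_of_le_mul_add (sq_nonneg α) (by nlinarith [hα.1, hα.2]) (genRate_nonneg α)
    (fun _ => le_rfl) tendsto_inv_two_pow

section SecondMoment

variable {Ω : Type*} [MeasurableSpace Ω] {Pr : Measure Ω} [IsProbabilityMeasure Pr]
  {P : Kernel (State d) (State d × State d)} [IsMarkovKernel P] {ν μ : Measure (State d)}
  {X : Node → Ω → State d}
  {F : Submodule ℝ (State d → ℝ)} {V : State d → ℝ} {α M : ℝ}

/-- The expected average over a generation of a function below `V ^ 2` is bounded uniformly in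
the generation, since the iterates of `V ^ 2` are dominated by a `ν`-integrable function. -/
theorem IsBMC.exists_integral_genAvg_le (hX : IsBMC Pr ν P X) (hF : StructuralAssumption P ν F)
    (hE : ErgodicAssumption P F μ V α M) :
    ∃ D : ℝ, 0 ≤ D ∧ ∀ g : State d → ℝ, IsBddMeasurable g → (∀ x, g x ≤ V x ^ 2) →
      ∀ k, ∫ ω, genAvg (fun u => g (X u ω)) k ∂Pr ≤ D := by
  have hV2 : (fun x => V x ^ 2) ∈ F := hF.sq_mem V hE.weight_mem
  obtain ⟨G, hG, hdom⟩ := hE.dominated _ hV2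
  have hG0 : ∀ x, 0 ≤ G x := fun x => (abs_nonneg _).trans (hdom 0 x)
  have : IsProbabilityMeasure ν := hX.initial ▸
    Measure.isProbabilityMeasure_map (hX.measurable []).aemeasurable
  refine ⟨∫ x, G x ∂ν, integral_nonneg hG0, fun g hg hgV k => ?_⟩
  rw [hX.integral_genAvg hg]
  refine integral_mono ((hg.applyQ_iterate k).integrable ν) (hF.integrable_initial G hG)
    fun x => le_trans ?_ ((le_abs_self _).trans (hdom k x))
  induction k generalizing x with
  | zero => exact hgV x
  | succ k ih =>
    rw [Function.iterate_succ_apply', Function.iterate_succ_apply']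
    exact applyQ_mono ((hg.applyQ_iterate k).integrable _)
      (hF.integrable_kernelQ (hF.applyQ_iterate_mem hV2 k) x) ih

/-- If the iterates of `g` decay geometrically, then so does, up to independent fluctuations, the
second moment of the average of `g` over a generation. -/
theorem IsBMC.integral_genAvg_sq_le_genRate (hX : IsBMC Pr ν P X) {D : ℝ} (hα : 0 < α)
    (hD : ∀ g : State d → ℝ, IsBddMeasurable g → (∀ x, g x ≤ V x ^ 2) →
      ∀ k, ∫ ω, genAvg (fun u => g (X u ω)) k ∂Pr ≤ D)
    {g : State d → ℝ} (hg : IsBddMeasurable g) {c : ℝ} (hc : 0 < c)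
    (hdecay : ∀ (n : ℕ) (x), |(applyQ P)^[n] g x| ≤ c * α ^ n * V x) (k : ℕ) :
    ∫ ω, genAvg (fun u => g (X u ω)) k ^ 2 ∂Pr ≤ c ^ 2 * D * genRate α k := by
  -- the hypothesis `hD` after scaling
  have bound : ∀ (g : State d → ℝ), IsBddMeasurable g → ∀ c : ℝ, 0 < c →
      (∀ x, |g x| ≤ c * V x) → ∀ k, ∫ ω, genAvg (fun u => g (X u ω) ^ 2) k ∂Pr ≤ c ^ 2 * D := by
    intro g hg c hc hgc k
    have h := hD (fun x => (c ^ 2)⁻¹ * g x ^ 2) (hg.sq.const_mul _) (fun x => by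
      rw [inv_mul_le_iff₀ (by positivity), ← mul_pow]
      exact sq_le_sq.2 ((hgc x).trans (le_abs_self _))) k
    simp only [genAvg_const_mul, integral_const_mul] at h
    rwa [inv_mul_le_iff₀ (by positivity)] at h
  induction k generalizing g c with
  | zero =>
    have h := bound g hg c hc (fun x => by simpa using hdecay 0 x) 0
    simp only [genAvg_zero, genRate, mul_one] at h ⊢
    exact h
  | succ k ih =>
    have h1 := hX.integral_genAvg_succ_sq_le hg k
    have h2 := ih hg.applyQ (mul_pos hc hα) fun n x => by
      have := hdecay (n + 1) x
      rw [Function.iterate_succ_apply, pow_succ] at this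
      linarith
    have h3 := bound g hg c hc (fun x => by simpa using hdecay 0 x) (k + 1)
    rw [hX.integral_genAvg_succ hg.sq] at h3
    have h4 := mul_le_mul_of_nonneg_left h3 (by positivity : (0 : ℝ) ≤ (2 ^ k : ℝ)⁻¹)
    rw [genRate]
    nlinarith

/-- The variance bound: `f` may be as large as `C * H`, but one averaging by `P` followed by
another by `Q` brings it down to the size `C`. The factor `H` then only enters through the
fluctuations in the last two generations. -/
theorem IsBMC.exists_integral_sq_sub_le (hX : IsBMC Pr ν P X) (hF : StructuralAssumption P ν F)
    [IsProbabilityMeasure μ] (hE : ErgodicAssumption P F μ V α M) {C : ℝ} (hC : 0 < C) :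
    ∃ A : ℝ, 0 ≤ A ∧ ∀ (f : State d × State d × State d → ℝ) (H c : ℝ), Measurable f → 1 ≤ H →
      (∀ y, |f y| ≤ C * H) → (∀ x, applyQ P (applyP P fun y => |f y|) x ≤ C) → |c| ≤ C →
      c = ∫ x, applyP P f x ∂μ →
      ∀ k, ∫ ω, (genAvg (fun u => f (triangle X u ω)) (k + 1) - c) ^ 2 ∂Pr ≤
        A * (genRate α k + (2 ^ k : ℝ)⁻¹ * H) := by
  obtain ⟨D, hD0, hD⟩ := hX.exists_integral_genAvg_le hF hE
  have hM := hE.const_nonneg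
  have hα := hE.rate_mem.1
  refine ⟨(2 * C * M + 1) ^ 2 * D + 8 * C ^ 2, by positivity, ?_⟩
  intro f H c hfm hH hfH hQP hcC hc k
  have hf : IsBddMeasurable f := ⟨hfm, _, hfH⟩
  have hft : IsBddMeasurable fun y => f y - c := hf.sub_const c
  -- the square of the centred function, averaged by `P` and `Q`, has size `H`
  have hsq : ∀ x, applyQ P (applyP P fun y => (f y - c) ^ 2) x ≤ 4 * C ^ 2 * H := by
    have e : ∀ y, (f y - c) ^ 2 ≤ 2 * (C * H) * |f y| + 2 * C ^ 2 := by
      intro y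
      have h1 : f y ^ 2 ≤ (C * H) * |f y| := by
        rw [← sq_abs, sq]; exact mul_le_mul_of_nonneg_right (hfH y) (abs_nonneg _)
      have h2 : c ^ 2 ≤ C ^ 2 := sq_le_sq.2 (hcC.trans (le_abs_self C))
      nlinarith [sq_nonneg (f y + c)]
    have hb : IsBddMeasurable fun y => 2 * (C * H) * |f y| + 2 * C ^ 2 :=
      (hf.abs.const_mul _).add (.const _)
    have hP : ∀ x, applyP P (fun y => (f y - c) ^ 2) x ≤
        2 * (C * H) * applyP P (fun y => |f y|) x + 2 * C ^ 2 := by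
      intro x
      refine (applyP_mono hft.sq hb e x).trans_eq ?_
      have hi := (hf.abs.comp (φ := fun y : State d × State d => (x, y.1, y.2))
        (by fun_prop)).integrable (P x)
      simp only [applyP]
      rw [integral_add (hi.const_mul _) (integrable_const _), integral_const_mul]
      simp
    intro x
    refine (applyQ_mono (hft.sq.applyP.integrable _)
      (((hf.abs.applyP.const_mul _).add (.const _)).integrable _) hP).trans ?_
    have hi := (hf.abs.applyP (P := P)).integrable (kernelQ P x)
    have : applyQ P (fun x => 2 * (C * H) * applyP P (fun y => |f y|) x + 2 * C ^ 2) x =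
        2 * (C * H) * applyQ P (applyP P fun y => |f y|) x + 2 * C ^ 2 := by
      simp only [applyQ]
      rw [integral_add (hi.const_mul _) (integrable_const _), integral_const_mul]
      simp
    rw [this]
    have h1 := mul_le_mul_of_nonneg_left (hQP x) (by positivity : 0 ≤ 2 * (C * H))
    have h2 : C ^ 2 ≤ C ^ 2 * H := le_mul_of_one_le_right (by positivity) hH
    linarith
  -- the centred function after two averagings, whose iterates decay geometrically
  have hdecay : ∀ (n : ℕ) (x), |(applyQ P)^[n] (applyQ P (applyP P fun y => f y - c)) x| ≤
      (2 * C * M + 1) * α ^ n * V x := by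
    have hψ : applyQ P (applyP P fun y => f y - c) = fun x => applyQ P (applyP P f) x - c := by
      rw [applyP_sub_const hf, applyQ_sub_const hf.applyP]
    have hψ0 : ∫ x, applyQ P (applyP P fun y => f y - c) x ∂μ = 0 := by
      rw [hψ, integral_sub (hf.applyP.applyQ.integrable μ) (integrable_const c),
        hE.integral_applyQ hf.applyP, ← hc]
      simp
    have hψC : ∀ x, |applyQ P (applyP P fun y => f y - c) x| ≤ 2 * C := by
      intro x
      rw [hψ]
      have h1 : |applyQ P (applyP P f) x| ≤ C := by
        refine le_trans ?_ (hQP x)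
        refine (abs_integral_le_integral_abs).trans ?_
        exact applyQ_mono (hf.applyP.abs.integrable _) (hf.abs.applyP.integrable _)
          fun y => abs_integral_le_integral_abs
      have := abs_sub (applyQ P (applyP P f) x) c
      linarith
    intro n x
    have h := hE.abs_iterate_sub_le hft.applyP.applyQ.measurable (by positivity : 0 < 2 * C)
      hψC n x
    rw [hψ0, sub_zero] at h
    have hV : 0 ≤ α ^ n * V x :=
      mul_nonneg (by positivity) (zero_le_one.trans (hE.one_le_weight x))
    linarith
  have h1 := hX.integral_genAvg_triangle_sq_le hft (k + 1)
  have h2 := hX.integral_genAvg_succ_sq_le (hft.applyP (P := P)) k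
  have h3 := hX.integral_genAvg_sq_le_genRate hα hD (hft.applyP (P := P)).applyQ
    (by positivity : 0 < 2 * C * M + 1) hdecay k
  have h4 : ∫ ω, genAvg (fun u => applyP P (fun y => (f y - c) ^ 2) (X u ω)) (k + 1) ∂Pr ≤
      4 * C ^ 2 * H := by
    rw [hX.integral_genAvg_succ hft.sq.applyP]
    exact hX.integral_genAvg_le hft.sq.applyP.applyQ hsq k
  have h5 : ∫ ω, genAvg (fun u => applyQ P (fun y => applyP P (fun y => f y - c) y ^ 2)
      (X u ω)) k ∂Pr ≤ 4 * C ^ 2 * H :=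
    hX.integral_genAvg_le hft.applyP.sq.applyQ (fun x => le_trans
      (applyQ_mono (hft.applyP.sq.integrable _) (hft.sq.applyP.integrable _) (sq_applyP_le hft))
      (hsq x)) k
  simp only [genAvg_sub_const] at h1
  have hi : (0 : ℝ) ≤ (2 ^ k : ℝ)⁻¹ := by positivity
  have h4' := mul_le_mul_of_nonneg_left h4 (by positivity : (0 : ℝ) ≤ (2 ^ (k + 1) : ℝ)⁻¹)
  have h5' := mul_le_mul_of_nonneg_left h5 hi
  have e2 : (2 ^ (k + 1) : ℝ)⁻¹ = 2⁻¹ * (2 ^ k : ℝ)⁻¹ := by rw [pow_succ, mul_inv]; ring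
  rw [e2] at h4' h1
  have hg := genRate_nonneg α k
  have hCH : 0 ≤ C ^ 2 * H * (2 ^ k : ℝ)⁻¹ := by positivity
  have hDg : 0 ≤ (2 * C * M + 1) ^ 2 * D * ((2 ^ k : ℝ)⁻¹ * H) := by positivity
  have hCg : 0 ≤ C ^ 2 * genRate α k := by positivity
  linarith

end SecondMoment

/-! ### Laws of large numbers over a generation and over the tree -/

theorem tendstoInMeasure_const_of_integral_sq {Ω : Type*} [MeasurableSpace Ω] {Pr : Measure Ω}
    [IsProbabilityMeasure Pr] {Y : ℕ → Ω → ℝ} {c : ℕ → ℝ} {l : ℝ}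
    (hY : ∀ n, IsBddMeasurable (Y n)) (hc : Tendsto c atTop (𝓝 l))
    (h : Tendsto (fun n => ∫ ω, (Y n ω - c n) ^ 2 ∂Pr) atTop (𝓝 0)) :
    TendstoInMeasure Pr Y atTop fun _ => l := by
  rw [tendstoInMeasure_iff_norm]
  intro ε hε
  have hlim : Tendsto (fun n => (ε ^ 2)⁻¹ * (2 * ∫ ω, (Y n ω - c n) ^ 2 ∂Pr +
      2 * (c n - l) ^ 2)) atTop (𝓝 0) := by
    have h1 : Tendsto (fun n => (c n - l) ^ 2) atTop (𝓝 0) := by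
      simpa using (hc.sub_const l).pow 2
    simpa using ((h.const_mul 2).add (h1.const_mul 2)).const_mul (ε ^ 2)⁻¹
  have hreal : Tendsto (fun n => Pr.real {ω | ε ≤ ‖Y n ω - l‖}) atTop (𝓝 0) := by
    refine squeeze_zero (fun _ => measureReal_nonneg) (fun n => ?_) hlim
    rw [le_inv_mul_iff₀ (by positivity)]
    have hb := ((hY n).sub_const l).sq
    have hset : {ω | ε ≤ ‖Y n ω - l‖} = {ω | ε ^ 2 ≤ (Y n ω - l) ^ 2} := by
      ext ω
      simp only [Set.mem_ofPred_eq, Real.norm_eq_abs]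
      rw [sq_le_sq, abs_of_pos hε]
    rw [hset]
    refine (mul_meas_ge_le_integral_of_nonneg (Eventually.of_forall fun ω => sq_nonneg _)
      (hb.integrable Pr) _).trans ?_
    have hi := (((hY n).sub_const (c n)).sq.integrable Pr).const_mul 2
    have := integral_mono (hb.integrable Pr) (hi.add (integrable_const (2 * (c n - l) ^ 2)))
      (fun ω => by
        change (Y n ω - l) ^ 2 ≤ 2 * (Y n ω - c n) ^ 2 + 2 * (c n - l) ^ 2
        nlinarith [sq_nonneg (Y n ω - c n - (c n - l))])
    refine this.trans_eq ?_
    simp only [Pi.add_apply]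
    rw [integral_add hi (integrable_const _), integral_const_mul]
    simp
  have := ENNReal.tendsto_ofReal hreal
  simpa [Measure.real, ENNReal.ofReal_toReal] using this

theorem sum_tree (Y : Node → ℝ) (n : ℕ) :
    ∑ u ∈ tree n, Y u = ∑ k ∈ Finset.range (n + 1), ∑ u ∈ gen k, Y u := by
  refine Finset.sum_biUnion fun i _ j _ hij => ?_
  refine Finset.disjoint_left.2 fun u hi hj => hij ?_
  rw [← mem_gen.1 hi, mem_gen.1 hj]

theorem card_tree (n : ℕ) : ((tree n).card : ℝ) = ∑ k ∈ Finset.range (n + 1), (2 : ℝ) ^ k := by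
  have h := sum_tree (fun _ => 1) n
  simpa [card_gen] using h

theorem two_pow_le_card_tree (n : ℕ) : (2 : ℝ) ^ n ≤ (tree n).card := by
  rw [card_tree]
  exact Finset.single_le_sum (f := fun k => (2 : ℝ) ^ k) (fun i _ => by positivity)
    (Finset.mem_range.2 n.lt_succ_self)

/-- The average over the tree is a convex combination of the averages over the generations. The
root is kept apart, as the variance bound does not cover it. -/
theorem sq_treeAvg_le (Y : Node → ℝ) (n : ℕ) :
    (((tree n).card : ℝ)⁻¹ * ∑ u ∈ tree n, Y u) ^ 2 ≤
      2 * ((2 ^ n : ℝ)⁻¹ * Y []) ^ 2 +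
        2 * ((2 ^ n : ℝ)⁻¹ * ∑ k ∈ Finset.range n, 2 ^ (k + 1) * genAvg Y (k + 1) ^ 2) := by
  have hN := two_pow_le_card_tree n
  have h2 : (0 : ℝ) < 2 ^ n := by positivity
  set N : ℝ := ((tree n).card : ℝ) with hNdef
  have hN0 : 0 < N := h2.trans_le hN
  have hNi : N⁻¹ ≤ (2 ^ n : ℝ)⁻¹ := inv_anti₀ h2 hN
  set B := ∑ k ∈ Finset.range n, 2 ^ (k + 1) * genAvg Y (k + 1) with hB
  set S := ∑ k ∈ Finset.range n, 2 ^ (k + 1) * genAvg Y (k + 1) ^ 2 with hS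
  have hS0 : 0 ≤ S := Finset.sum_nonneg fun k _ => by positivity
  have hsum : ∑ u ∈ tree n, Y u = B + Y [] := by
    have e : ∀ k, ∑ u ∈ gen k, Y u = 2 ^ k * genAvg Y k := fun k => by
      rw [genAvg, mul_inv_cancel_left₀ (by positivity)]
    rw [sum_tree, Finset.sum_range_succ', e 0, genAvg_zero, pow_zero, one_mul]
    simp only [e, hB]
  have hW : ∑ k ∈ Finset.range n, (2 : ℝ) ^ (k + 1) ≤ N := by
    rw [hNdef, card_tree, Finset.sum_range_succ']
    simp
  have hBS : B ^ 2 ≤ N * S := by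
    refine (Finset.sum_sq_le_sum_mul_sum_of_sq_le_mul _ (f := fun k => (2 : ℝ) ^ (k + 1))
      (g := fun k => 2 ^ (k + 1) * genAvg Y (k + 1) ^ 2) (fun i _ => by positivity)
      (fun i _ => by positivity) (fun i _ => le_of_eq (by ring))).trans ?_
    exact mul_le_mul_of_nonneg_right hW hS0
  have h3 : (N⁻¹ * B) ^ 2 ≤ (2 ^ n : ℝ)⁻¹ * S := by
    calc (N⁻¹ * B) ^ 2 = N⁻¹ ^ 2 * B ^ 2 := mul_pow _ _ _
      _ ≤ N⁻¹ ^ 2 * (N * S) := by gcongr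
      _ = N⁻¹ * S := by field_simp
      _ ≤ _ := by gcongr
  have h4 : (N⁻¹ * Y []) ^ 2 ≤ ((2 ^ n : ℝ)⁻¹ * Y []) ^ 2 := by
    rw [mul_pow, mul_pow]; gcongr
  rw [hsum, mul_add]
  nlinarith [sq_nonneg (N⁻¹ * B - N⁻¹ * Y [])]

section LLN

variable {Ω : Type*} [MeasurableSpace Ω] {Pr : Measure Ω} [IsProbabilityMeasure Pr]
  {P : Kernel (State d) (State d × State d)} [IsMarkovKernel P] {ν μ : Measure (State d)}
  [IsProbabilityMeasure μ] {X : Node → Ω → State d}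
  {F : Submodule ℝ (State d → ℝ)} {V : State d → ℝ} {α M : ℝ}

/-- A law of large numbers over generations and over the tree, for functions `f n` that may grow
like `H n`, provided that they are of bounded size once averaged by `P` and `Q`. -/
theorem IsBMC.tendstoInMeasure_avg (hX : IsBMC Pr ν P X) (hF : StructuralAssumption P ν F)
    (hE : ErgodicAssumption P F μ V α M) {f : ℕ → State d × State d × State d → ℝ} {H : ℕ → ℝ}
    {C l : ℝ} (hf : ∀ n, Measurable (f n)) (hC : 0 < C) (hH : ∀ n, 1 ≤ H n)
    (hfH : ∀ n y, |f n y| ≤ C * H n)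
    (hQP : ∀ n x, applyQ P (applyP P fun y => |f n y|) x ≤ C)
    (hHlim : Tendsto (fun n : ℕ => n * ((2 ^ n : ℝ)⁻¹ * H n)) atTop (𝓝 0))
    (hl : Tendsto (fun n => ∫ x, applyP P (f n) x ∂μ) atTop (𝓝 l)) :
    TendstoInMeasure Pr
        (fun n ω => ((gen n).card : ℝ)⁻¹ * ∑ u ∈ gen n, f n (triangle X u ω)) atTop
        (fun _ => l) ∧
      TendstoInMeasure Pr
        (fun n ω => ((tree n).card : ℝ)⁻¹ * ∑ u ∈ tree n, f n (triangle X u ω)) atTop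
        (fun _ => l) := by
  set c : ℕ → ℝ := fun n => ∫ x, applyP P (f n) x ∂μ with hc
  obtain ⟨B, hB⟩ := hl.abs.bddAbove_range
  have hcB : ∀ n, |c n| ≤ B := fun n => hB (Set.mem_range_self n)
  have hB0 : 0 ≤ B := (abs_nonneg _).trans (hcB 0)
  have hH0 : ∀ n, 0 ≤ H n := fun n => zero_le_one.trans (hH n)
  have hfB : ∀ n y, |f n y| ≤ (C + B) * H n := fun n y =>
    (hfH n y).trans (mul_le_mul_of_nonneg_right (by linarith) (hH0 n))
  -- the centring constants converge, hence are bounded, and `C` is enlarged to cover them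
  obtain ⟨A, hA0, hA⟩ := hX.exists_integral_sq_sub_le hF hE (by positivity : 0 < C + B)
  have hvar : ∀ n k, ∫ ω, (genAvg (fun u => f n (triangle X u ω)) (k + 1) - c n) ^ 2 ∂Pr ≤
      A * (genRate α k + (2 ^ k : ℝ)⁻¹ * H n) := fun n k =>
    hA (f n) (H n) (c n) (hf n) (hH n) (hfB n) (fun x => (hQP n x).trans (by linarith))
      ((hcB n).trans (by linarith)) rfl k
  have hbdd : ∀ n, IsBddMeasurable (f n) := fun n => ⟨hf n, _, hfH n⟩
  have hT : ∀ n u, IsBddMeasurable fun ω => f n (triangle X u ω) :=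
    fun n u => (hbdd n).comp (hX.measurable_triangle u)
  have hHlim' : Tendsto (fun n : ℕ => (2 ^ n : ℝ)⁻¹ * H n) atTop (𝓝 0) := by
    refine tendsto_of_tendsto_of_tendsto_of_le_of_le' tendsto_const_nhds hHlim
      (Eventually.of_forall fun n => mul_nonneg (by positivity) (hH0 n)) ?_
    filter_upwards [eventually_ge_atTop 1] with n hn
    exact le_mul_of_one_le_left (mul_nonneg (by positivity) (hH0 n)) (by exact_mod_cast hn)
  have hrate := tendsto_genRate hE.rate_mem
  constructor
  · -- the variance bound starts at the first generation, whence the shift of the index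
    refine tendstoInMeasure_const_of_integral_sq
      (fun n => (IsBddMeasurable.sum _ fun u _ => hT n u).const_mul _) hl ?_
    rw [← tendsto_add_atTop_iff_nat 1]
    have hlim : Tendsto (fun n => A * (genRate α n + 2 * ((2 ^ (n + 1) : ℝ)⁻¹ * H (n + 1))))
        atTop (𝓝 0) := by
      simpa using (hrate.add
        (((tendsto_add_atTop_iff_nat 1).2 hHlim').const_mul 2)).const_mul A
    refine squeeze_zero (fun n => integral_nonneg fun ω => sq_nonneg _) (fun n => ?_) hlim
    have h := hvar (n + 1) n
    simp only [genAvg] at h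
    simp only [card_gen, Nat.cast_pow, Nat.cast_ofNat]
    refine h.trans_eq ?_
    rw [pow_succ, mul_inv]
    ring
  · refine tendstoInMeasure_const_of_integral_sq
      (fun n => (IsBddMeasurable.sum _ fun u _ => hT n u).const_mul _) hl ?_
    -- the rates averaged over the tree
    set t : ℕ → ℝ := fun n => (2 ^ n : ℝ)⁻¹ * ∑ k ∈ Finset.range n, 2 ^ k * genRate α k with ht
    have htlim : Tendsto t atTop (𝓝 0) := by
      refine tendsto_zero_of_le_mul_add (r := 2⁻¹) (b := fun n => 2⁻¹ * genRate α n)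
        (by norm_num) (by norm_num) (fun n => mul_nonneg (by positivity)
          (Finset.sum_nonneg fun k _ => mul_nonneg (by positivity) (genRate_nonneg α k)))
        (fun n => le_of_eq ?_) (by simpa using hrate.const_mul 2⁻¹)
      simp only [ht]
      rw [Finset.sum_range_succ, pow_succ, mul_inv]
      field_simp
    have hlim : Tendsto (fun n : ℕ => 2 * ((C + B) * 2) ^ 2 * ((2 ^ n : ℝ)⁻¹ * H n) ^ 2 +
        4 * A * (t n + n * ((2 ^ n : ℝ)⁻¹ * H n))) atTop (𝓝 0) := by
      simpa using ((hHlim'.pow 2).const_mul (2 * ((C + B) * 2) ^ 2)).add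
        ((htlim.add hHlim).const_mul (4 * A))
    refine squeeze_zero (fun n => integral_nonneg fun ω => sq_nonneg _) (fun n => ?_) hlim
    have hN0 : (0 : ℝ) < (tree n).card := lt_of_lt_of_le (by positivity) (two_pow_le_card_tree n)
    have hcentre : ∀ ω, ((tree n).card : ℝ)⁻¹ * ∑ u ∈ tree n, f n (triangle X u ω) - c n =
        ((tree n).card : ℝ)⁻¹ * ∑ u ∈ tree n, (f n (triangle X u ω) - c n) := fun ω => by
      rw [Finset.sum_sub_distrib, Finset.sum_const, nsmul_eq_mul]
      field_simp
    have hroot : ∀ ω, ((2 ^ n : ℝ)⁻¹ * (f n (triangle X [] ω) - c n)) ^ 2 ≤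
        ((C + B) * 2) ^ 2 * ((2 ^ n : ℝ)⁻¹ * H n) ^ 2 := by
      intro ω
      have h1 : |f n (triangle X [] ω) - c n| ≤ (C + B) * 2 * H n := by
        have h2 := abs_sub (f n (triangle X [] ω)) (c n)
        have h3 := hfB n (triangle X [] ω)
        have h4 : B ≤ (C + B) * H n := by nlinarith [hH n]
        linarith [hcB n]
      have h2 := sq_le_sq' (abs_le.1 h1).1 (abs_le.1 h1).2
      have h3 := mul_le_mul_of_nonneg_left h2 (sq_nonneg (2 ^ n : ℝ)⁻¹)
      calc _ = _ := mul_pow _ _ _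
        _ ≤ _ := h3
        _ = _ := by ring
    have hsqb : ∀ k, IsBddMeasurable fun ω =>
        2 ^ (k + 1) * (genAvg (fun u => f n (triangle X u ω)) (k + 1) - c n) ^ 2 := fun k =>
      ((isBddMeasurable_genAvg (hT n) (k + 1)).sub_const (c n)).sq.const_mul _
    have hS : IsBddMeasurable fun ω => 2 * ((2 ^ n : ℝ)⁻¹ * ∑ k ∈ Finset.range n,
        2 ^ (k + 1) * (genAvg (fun u => f n (triangle X u ω)) (k + 1) - c n) ^ 2) :=
      ((IsBddMeasurable.sum _ fun k _ => hsqb k).const_mul _).const_mul _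
    calc ∫ ω, (((tree n).card : ℝ)⁻¹ * ∑ u ∈ tree n, f n (triangle X u ω) - c n) ^ 2 ∂Pr
        ≤ ∫ ω, (2 * (((C + B) * 2) ^ 2 * ((2 ^ n : ℝ)⁻¹ * H n) ^ 2) +
          2 * ((2 ^ n : ℝ)⁻¹ * ∑ k ∈ Finset.range n,
            2 ^ (k + 1) * (genAvg (fun u => f n (triangle X u ω)) (k + 1) - c n) ^ 2)) ∂Pr := by
          refine integral_mono ((((IsBddMeasurable.sum _ fun u _ => hT n u).const_mul
            _).sub_const _).sq.integrable Pr) ((integrable_const _).add (hS.integrable Pr))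
            fun ω => ?_
          have h := sq_treeAvg_le (fun u => f n (triangle X u ω) - c n) n
          simp only [genAvg_sub_const] at h
          simp only [hcentre]
          linarith [hroot ω]
      _ = 2 * (((C + B) * 2) ^ 2 * ((2 ^ n : ℝ)⁻¹ * H n) ^ 2) + 2 * ((2 ^ n : ℝ)⁻¹ *
          ∑ k ∈ Finset.range n, 2 ^ (k + 1) *
            ∫ ω, (genAvg (fun u => f n (triangle X u ω)) (k + 1) - c n) ^ 2 ∂Pr) := by
          rw [integral_add (integrable_const _) (hS.integrable Pr)]
          simp only [integral_const_mul]
          rw [integral_finsetSum _ fun k _ => (hsqb k).integrable Pr]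
          simp only [integral_const_mul]
          simp
      _ ≤ 2 * (((C + B) * 2) ^ 2 * ((2 ^ n : ℝ)⁻¹ * H n) ^ 2) + 2 * ((2 ^ n : ℝ)⁻¹ *
          ∑ k ∈ Finset.range n, 2 ^ (k + 1) * (A * (genRate α k + (2 ^ k : ℝ)⁻¹ * H n))) := by
          gcongr with k hk
          exact hvar n k
      _ = _ := by
          have e : ∀ k, (2 : ℝ) ^ (k + 1) * (A * (genRate α k + (2 ^ k : ℝ)⁻¹ * H n)) =
              2 * A * (2 ^ k * genRate α k) + 2 * A * H n := fun k => by
            rw [pow_succ]; field_simp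
          simp only [e, Finset.sum_add_distrib, ← Finset.mul_sum, ht, Finset.sum_const,
            Finset.card_range, nsmul_eq_mul]
          ring

end LLN

/-! ### Approximate identities -/

section ApproximateIdentity

variable {E : Type*} [NormedAddCommGroup E] [NormedSpace ℝ E] [FiniteDimensional ℝ E]
  [MeasurableSpace E] [BorelSpace E] (vol : Measure E) [vol.IsAddHaarMeasure]

theorem integral_comp_inv_smul_sub (g : E → ℝ) {h : ℝ} (hh : 0 < h) (x : E) :
    ∫ y, g (h⁻¹ • (x - y)) ∂vol = h ^ Module.finrank ℝ E * ∫ y, g y ∂vol := by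
  rw [integral_sub_left_eq_self (fun y => g (h⁻¹ • y)) vol x, Measure.integral_comp_inv_smul,
    abs_of_pos (by positivity), smul_eq_mul]

variable {vol}

theorem integrable_comp_inv_smul_sub {g : E → ℝ} (hg : Integrable g vol) {h : ℝ} (hh : 0 < h)
    (x : E) : Integrable (fun y => g (h⁻¹ • (x - y))) vol :=
  (hg.comp_smul (inv_pos.2 hh).ne').comp_sub_left x

/-- Rescalings of a kernel of integral one, which may change sign, recover a bounded function at
its points of continuity. -/
theorem tendsto_integral_approximateIdentity {K G : E → ℝ} (hK : Integrable K vol)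
    (hK1 : ∫ y, K y ∂vol = 1) (hG : IsBddMeasurable G) {x : E} (hGx : ContinuousAt G x)
    {h : ℕ → ℝ} (hpos : ∀ n, 0 < h n) (hh : Tendsto h atTop (𝓝 0)) :
    Tendsto (fun n => ∫ y, (h n ^ Module.finrank ℝ E)⁻¹ * K ((h n)⁻¹ • (x - y)) * G y ∂vol)
      atTop (𝓝 (G x)) := by
  have e : ∀ n, ∫ y, (h n ^ Module.finrank ℝ E)⁻¹ * K ((h n)⁻¹ • (x - y)) * G y ∂vol =
      ∫ w, K w * G (x - h n • w) ∂vol := by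
    intro n
    have h1 := integral_comp_inv_smul_sub vol (fun w => K w * G (x - h n • w)) (hpos n) x
    have h2 : ∀ y, x - h n • (h n)⁻¹ • (x - y) = y := fun y => by
      rw [smul_inv_smul₀ (hpos n).ne']; abel
    simp only [h2] at h1
    have := (hpos n).ne'
    simp only [mul_assoc]
    rw [integral_const_mul, h1, inv_mul_cancel_left₀ (by positivity)]
  simp only [e]
  -- dominated convergence, after the change of variables `w = h⁻¹ (x - y)`
  obtain ⟨C, hC⟩ := hG.bounded
  have hlim : ∫ w, K w * G x ∂vol = G x := by rw [integral_mul_const, hK1, one_mul]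
  rw [← hlim]
  refine tendsto_integral_of_dominated_convergence (fun w => ‖K w‖ * C) (fun n => ?_)
    (hK.norm.mul_const C) (fun n => Eventually.of_forall fun w => ?_)
    (Eventually.of_forall fun w => ?_)
  · refine hK.aestronglyMeasurable.mul (Measurable.aestronglyMeasurable ?_)
    exact hG.measurable.comp (by fun_prop)
  · rw [norm_mul]
    exact mul_le_mul_of_nonneg_left (hC _) (norm_nonneg _)
  · refine Tendsto.const_mul _ (hGx.tendsto.comp ?_)
    simpa using (hh.smul_const w).const_sub x

end ApproximateIdentity

/-! ### Bounded transition densities -/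

section Density

variable {P : Kernel (State d) (State d × State d)} {p : State d → State d → State d → ℝ}
  {μ : Measure (State d)} {m : State d → ℝ}

theorem le_densityBound (m : State d → ℝ) (p : State d → State d → State d → ℝ)
    (x x₀ x₁ : State d) :
    ENNReal.ofReal (m x) + densityQ p x x₀ + ENNReal.ofReal (p x x₀ x₁) ≤ densityBound m p :=
  le_iSup_of_le x (le_iSup_of_le x₀ (le_iSup_of_le x₁ le_rfl))

theorem density_le (hC : densityBound m p < ⊤) (x : State d) :
    m x ≤ (densityBound m p).toReal :=
  (ENNReal.ofReal_le_iff_le_toReal hC.ne).1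
    ((le_self_add.trans le_self_add).trans (le_densityBound m p x 0 0))

theorem transitionDensity_le (hC : densityBound m p < ⊤) (x x₀ x₁ : State d) :
    p x x₀ x₁ ≤ (densityBound m p).toReal :=
  (ENNReal.ofReal_le_iff_le_toReal hC.ne).1 (le_add_self.trans (le_densityBound m p x x₀ x₁))

theorem densityQ_le (m : State d → ℝ) (p : State d → State d → State d → ℝ) (x y : State d) :
    densityQ p x y ≤ densityBound m p :=
  (le_add_self.trans le_self_add).trans (le_densityBound m p x y 0)

/-- By Tonelli's theorem `Q` has the density `densityQ p`, which is at most the bound. -/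
theorem kernelQ_le (hp : IsTransitionDensity P p) (m : State d → ℝ) (x : State d) :
    kernelQ P x ≤ densityBound m p • volume := by
  have hpx : Measurable fun y : State d × State d => ENNReal.ofReal (p x y.1 y.2) :=
    (hp.measurable.comp (g := fun y : State d × State d × State d => p y.1 y.2.1 y.2.2)
      (f := fun y : State d × State d => (x, y.1, y.2)) (by fun_prop)).ennreal_ofReal
  refine Measure.le_iff.2 fun s hs => ?_
  have h0 : P.fst x s = ∫⁻ y in s, ∫⁻ z, ENNReal.ofReal (p x y z) := by
    rw [Kernel.fst_apply, Measure.map_apply measurable_fst hs, hp.eq_withDensity,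
      withDensity_apply _ (measurable_fst hs), ← Set.prod_univ, Measure.volume_eq_prod,
      ← Measure.prod_restrict, Measure.restrict_univ, lintegral_prod _ hpx.aemeasurable]
  have h1 : P.snd x s = ∫⁻ y in s, ∫⁻ z, ENNReal.ofReal (p x z y) := by
    rw [Kernel.snd_apply, Measure.map_apply measurable_snd hs, hp.eq_withDensity,
      withDensity_apply _ (measurable_snd hs), ← Set.univ_prod, Measure.volume_eq_prod,
      ← Measure.prod_restrict, Measure.restrict_univ, lintegral_prod_symm _ hpx.aemeasurable]
  have hm0 : Measurable fun y => ∫⁻ z, ENNReal.ofReal (p x y z) := hpx.lintegral_prod_right'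
  calc kernelQ P x s = 2⁻¹ * (P.fst x s + P.snd x s) := rfl
    _ = ∫⁻ y in s, densityQ p x y := by
      rw [h0, h1, ← lintegral_add_left hm0, ← lintegral_const_mul' _ _ (by simp)]
      refine lintegral_congr fun y => ?_
      rw [densityQ, lintegral_add_left]
      exact hpx.comp (g := fun q : State d × State d => ENNReal.ofReal (p x q.1 q.2))
        measurable_prodMk_left
    _ ≤ ∫⁻ _ in s, densityBound m p := lintegral_mono fun y => densityQ_le m p x y
    _ = (densityBound m p • volume) s := by simp

theorem applyQ_le (hp : IsTransitionDensity P p) (hC : densityBound m p < ⊤)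
    {f : State d → ℝ} (hf : Integrable f) (hf0 : ∀ y, 0 ≤ f y) (x : State d) :
    applyQ P f x ≤ (densityBound m p).toReal * ∫ y, f y := by
  refine (integral_mono_measure (kernelQ_le hp m x) (Eventually.of_forall hf0)
    (hf.smul_measure hC.ne)).trans_eq ?_
  rw [integral_smul_measure, smul_eq_mul]

theorem applyP_eq (hp : IsTransitionDensity P p) (f : State d × State d × State d → ℝ)
    (x : State d) : applyP P f x = ∫ y : State d × State d, p x y.1 y.2 * f (x, y) := by
  have hpx : Measurable fun y : State d × State d => ENNReal.ofReal (p x y.1 y.2) :=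
    (hp.measurable.comp (g := fun y : State d × State d × State d => p y.1 y.2.1 y.2.2)
      (f := fun y : State d × State d => (x, y.1, y.2)) (by fun_prop)).ennreal_ofReal
  rw [applyP, hp.eq_withDensity, integral_withDensity_eq_integral_toReal_smul hpx (by simp)]
  simp [ENNReal.toReal_ofReal (hp.nonneg _ _ _)]

theorem applyP_le (hp : IsTransitionDensity P p) (hC : densityBound m p < ⊤)
    {f : State d × State d × State d → ℝ} {x : State d}
    (hf : Integrable fun y : State d × State d => f (x, y)) (hf0 : ∀ y, 0 ≤ f y) :
    applyP P f x ≤ (densityBound m p).toReal * ∫ y : State d × State d, f (x, y) := by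
  rw [applyP_eq hp, ← integral_const_mul]
  exact integral_mono_of_nonneg
    (Eventually.of_forall fun y => mul_nonneg (hp.nonneg _ _ _) (hf0 _)) (hf.const_mul _)
    (Eventually.of_forall fun y =>
      mul_le_mul_of_nonneg_right (transitionDensity_le hC _ _ _) (hf0 _))

theorem IsLebesgueDensity.integral_eq (hm : IsLebesgueDensity μ m) (f : State d → ℝ) :
    ∫ y, f y ∂μ = ∫ y, m y * f y := by
  rw [hm.eq_withDensity, integral_withDensity_eq_integral_toReal_smul
    hm.measurable.ennreal_ofReal (by simp)]
  simp [ENNReal.toReal_ofReal (hm.nonneg _)]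

/-- The function `m(y) p(y, y₀, y₁)` is the density of `μ(dy) P(y, dy₀, dy₁)`. -/
theorem integral_applyP (hp : IsTransitionDensity P p) (hm : IsLebesgueDensity μ m)
    (hC : densityBound m p < ⊤) {f : State d × State d × State d → ℝ} (hf : Integrable f) :
    ∫ x, applyP P f x ∂μ =
      ∫ y : State d × State d × State d, f y * (m y.1 * p y.1 y.2.1 y.2.2) := by
  have hi : Integrable fun y : State d × State d × State d =>
      f y * (m y.1 * p y.1 y.2.1 y.2.2) := by
    refine hf.mul_bdd (c := (densityBound m p).toReal * (densityBound m p).toReal)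
      (((hm.measurable.comp measurable_fst).mul hp.measurable).aestronglyMeasurable)
      (Eventually.of_forall fun y => ?_)
    rw [Real.norm_of_nonneg (mul_nonneg (hm.nonneg _) (hp.nonneg _ _ _))]
    exact mul_le_mul (density_le hC _) (transitionDensity_le hC _ _ _) (hp.nonneg _ _ _)
      ENNReal.toReal_nonneg
  rw [hm.integral_eq, Measure.volume_eq_prod, integral_prod _ hi]
  refine integral_congr_ae (Eventually.of_forall fun x => ?_)
  simp only
  rw [applyP_eq hp, ← integral_const_mul]
  refine integral_congr_ae (Eventually.of_forall fun y => ?_)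
  simp only
  ring

end Density

/-! ### Quotients and convergence in measure -/

theorem tendstoInMeasure_div_const {Ω : Type*} [MeasurableSpace Ω] {Pr : Measure Ω}
    {Y Z : ℕ → Ω → ℝ} {a b : ℝ} (hY : TendstoInMeasure Pr Y atTop fun _ => a)
    (hZ : TendstoInMeasure Pr Z atTop fun _ => b) (hb : b ≠ 0) :
    TendstoInMeasure Pr (fun n ω => Y n ω / Z n ω) atTop fun _ => a / b := by
  rw [tendstoInMeasure_iff_norm] at hY hZ ⊢
  intro ε hε
  have hcont : ContinuousAt (fun q : ℝ × ℝ => q.1 / q.2) (a, b) :=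
    continuousAt_fst.div continuousAt_snd hb
  obtain ⟨δ, hδ, hdiv⟩ := Metric.continuousAt_iff.1 hcont ε hε
  have hlim := (hY δ hδ).add (hZ δ hδ)
  rw [add_zero] at hlim
  refine tendsto_of_tendsto_of_tendsto_of_le_of_le tendsto_const_nhds hlim
    (fun _ => zero_le) fun n => ?_
  refine (measure_mono fun ω hω => ?_).trans (measure_union_le _ _)
  by_contra hnot
  simp only [Set.mem_union, Set.mem_ofPred_eq, not_or, not_le] at hnot hω
  refine absurd (hdiv (x := (Y n ω, Z n ω)) ?_) (not_lt.2 hω)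
  rw [Prod.dist_eq]
  exact max_lt hnot.1 hnot.2

/-! ### The kernel estimators -/

/-- The kernel density estimator at `x` is the average of this function over the triangles. -/
noncomputable def smoothedPoint (K₀ : State d → ℝ) (h : ℝ) (x : State d)
    (y : State d × State d × State d) : ℝ :=
  (h ^ d)⁻¹ * K₀ (h⁻¹ • (x - y.1))

/-- The kernel density estimator at `(x, x₀, x₁)` is the average of this function over the
triangles. -/
noncomputable def smoothedTriangle (K₀ : State d → ℝ) (h : ℝ) (x x₀ x₁ : State d)
    (y : State d × State d × State d) : ℝ :=
  (h ^ (3 * d))⁻¹ * tensorKernel K₀ (h⁻¹ • (x - y.1)) (h⁻¹ • (x₀ - y.2.1)) (h⁻¹ • (x₁ - y.2.2))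

theorem muHat_eq {Ω : Type*} (X : Node → Ω → State d) (K₀ : State d → ℝ) (A : Finset Node) {h : ℝ}
    (hh : 0 < h) (x : State d) (ω : Ω) :
    muHat X K₀ A h x ω = (A.card : ℝ)⁻¹ * ∑ u ∈ A, smoothedPoint K₀ h x (triangle X u ω) := by
  have e : h ^ ((d : ℝ) / 2) * h ^ ((d : ℝ) / 2) = h ^ d := by
    rw [← Real.rpow_add hh, add_halves, Real.rpow_natCast]
  simp only [muHat, scaledKernel, smoothedPoint, triangle, ← Finset.mul_sum, ← e,
    Real.rpow_neg hh.le, one_div, mul_inv]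
  ring

theorem muTriangleHat_eq {Ω : Type*} (X : Node → Ω → State d) (K₀ : State d → ℝ)
    (A : Finset Node) {h : ℝ} (hh : 0 < h) (x x₀ x₁ : State d) (ω : Ω) :
    muTriangleHat X K₀ A h x x₀ x₁ ω =
      (A.card : ℝ)⁻¹ * ∑ u ∈ A, smoothedTriangle K₀ h x x₀ x₁ (triangle X u ω) := by
  have e : h ^ (3 * (d : ℝ) / 2) * h ^ (3 * (d : ℝ) / 2) = h ^ (3 * d) := by
    rw [← Real.rpow_add hh, add_halves, ← Real.rpow_natCast]
    push_cast
    rfl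
  simp only [muTriangleHat, scaledTensorKernel, smoothedTriangle, triangle, ← Finset.mul_sum, ← e,
    Real.rpow_neg hh.le, one_div, mul_inv]
  ring

section Estimators

variable {P : Kernel (State d) (State d × State d)} {p : State d → State d → State d → ℝ}
  {μ : Measure (State d)} {m : State d → ℝ} {K₀ : State d → ℝ}

theorem finrank_state : Module.finrank ℝ (State d) = d := by simp

theorem finrank_state_triple : Module.finrank ℝ (State d × State d × State d) = 3 * d := by
  simp only [Module.finrank_prod, finrank_state]
  ring

theorem measurable_smoothedPoint (hK : IsSmoothingKernel K₀) (h : ℝ) (x : State d) :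
    Measurable (smoothedPoint K₀ h x) :=
  (hK.measurable.comp (by fun_prop)).const_mul _

theorem measurable_smoothedTriangle (hK : IsSmoothingKernel K₀) (h : ℝ) (x x₀ x₁ : State d) :
    Measurable (smoothedTriangle K₀ h x x₀ x₁) :=
  (((hK.measurable.comp (by fun_prop)).mul (hK.measurable.comp (by fun_prop))).mul
    (hK.measurable.comp (by fun_prop))).const_mul _

/-- The rescaled kernel has an integral that does not depend on the bandwidth, and the density
of `Q` is bounded. -/
theorem applyQ_smoothed_le (hp : IsTransitionDensity P p) (hC : densityBound m p < ⊤)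
    (hK : IsSmoothingKernel K₀) {h : ℝ} (hh : 0 < h) (x y : State d) :
    applyQ P (fun y => (h ^ d)⁻¹ * |K₀ (h⁻¹ • (x - y))|) y ≤
      (densityBound m p).toReal * ∫ y, |K₀ y| := by
  refine (applyQ_le hp hC ((integrable_comp_inv_smul_sub hK.integrable.abs hh x).const_mul _)
    (fun y => by positivity) y).trans_eq ?_
  rw [integral_const_mul, integral_comp_inv_smul_sub volume (fun y => |K₀ y|) hh, finrank_state,
    inv_mul_cancel_left₀ (by positivity)]

theorem applyP_abs_smoothedPoint [IsMarkovKernel P] (K₀ : State d → ℝ) {h : ℝ} (hh : 0 < h)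
    (x : State d) :
    applyP P (fun y => |smoothedPoint K₀ h x y|) = fun y => (h ^ d)⁻¹ * |K₀ (h⁻¹ • (x - y))| := by
  funext y
  have : 0 ≤ (h ^ d)⁻¹ := by positivity
  simp [applyP, smoothedPoint, abs_mul, abs_of_nonneg this]

theorem applyP_abs_smoothedTriangle_le (hp : IsTransitionDensity P p)
    (hC : densityBound m p < ⊤) (hK : IsSmoothingKernel K₀) {h : ℝ} (hh : 0 < h)
    (x x₀ x₁ y : State d) :
    applyP P (fun y => |smoothedTriangle K₀ h x x₀ x₁ y|) y ≤
      (densityBound m p).toReal * (∫ y, |K₀ y|) ^ 2 * ((h ^ d)⁻¹ * |K₀ (h⁻¹ • (x - y))|) := by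
  have e : (fun z : State d × State d => |smoothedTriangle K₀ h x x₀ x₁ (y, z)|) =
      fun z => (h ^ (3 * d))⁻¹ * |K₀ (h⁻¹ • (x - y))| *
        (|K₀ (h⁻¹ • (x₀ - z.1))| * |K₀ (h⁻¹ • (x₁ - z.2))|) := by
    funext z
    have h0 : 0 ≤ (h ^ (3 * d))⁻¹ := by positivity
    rw [smoothedTriangle, tensorKernel, abs_mul, abs_mul, abs_mul, abs_of_nonneg h0]
    ring
  have hi : Integrable fun z : State d × State d =>
      |K₀ (h⁻¹ • (x₀ - z.1))| * |K₀ (h⁻¹ • (x₁ - z.2))| :=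
    (integrable_comp_inv_smul_sub hK.integrable.abs hh x₀).mul_prod
      (integrable_comp_inv_smul_sub hK.integrable.abs hh x₁)
  refine (applyP_le hp hC (e ▸ hi.const_mul _) fun _ => abs_nonneg _).trans_eq ?_
  rw [e, integral_const_mul, Measure.volume_eq_prod,
    integral_prod_mul (fun y => |K₀ (h⁻¹ • (x₀ - y))|) (fun y => |K₀ (h⁻¹ • (x₁ - y))|),
    integral_comp_inv_smul_sub volume (fun y => |K₀ y|) hh,
    integral_comp_inv_smul_sub volume (fun y => |K₀ y|) hh, finrank_state]
  have := hh.ne'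
  rw [show h ^ (3 * d) = (h ^ d) ^ 3 by ring]
  field_simp

theorem abs_smoothedPoint_le {b : ℝ} (hb : ∀ y, |K₀ y| ≤ b) {h : ℝ} (hh : 0 < h) (hh1 : h ≤ 1)
    (x : State d) (y : State d × State d × State d) :
    |smoothedPoint K₀ h x y| ≤ b * (h ^ (3 * d))⁻¹ := by
  have h0 : 0 ≤ (h ^ d)⁻¹ := by positivity
  have h1 : (h ^ d)⁻¹ ≤ (h ^ (3 * d))⁻¹ :=
    inv_anti₀ (by positivity) (pow_le_pow_of_le_one hh.le hh1 (by omega))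
  rw [smoothedPoint, abs_mul, abs_of_nonneg h0, mul_comm]
  exact mul_le_mul (hb _) h1 h0 ((abs_nonneg _).trans (hb 0))

theorem abs_smoothedTriangle_le {b : ℝ} (hb : ∀ y, |K₀ y| ≤ b) {h : ℝ} (hh : 0 < h)
    (x x₀ x₁ : State d) (y : State d × State d × State d) :
    |smoothedTriangle K₀ h x x₀ x₁ y| ≤ b ^ 3 * (h ^ (3 * d))⁻¹ := by
  have h0 : 0 ≤ (h ^ (3 * d))⁻¹ := by positivity
  have hb0 : 0 ≤ b := (abs_nonneg _).trans (hb 0)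
  rw [smoothedTriangle, tensorKernel, abs_mul, abs_mul, abs_mul, abs_of_nonneg h0, mul_comm,
    pow_succ, sq]
  gcongr <;> exact hb _

variable {h : ℕ → ℝ}

theorem tendsto_integral_smoothedPoint [IsMarkovKernel P] (hm : IsLebesgueDensity μ m)
    (hC : densityBound m p < ⊤) (hK : IsSmoothingKernel K₀) (hpos : ∀ n, 0 < h n)
    (hh : Tendsto h atTop (𝓝 0)) {x : State d} (hx : ContinuousAt m x) :
    Tendsto (fun n => ∫ y, applyP P (smoothedPoint K₀ (h n) x) y ∂μ) atTop (𝓝 (m x)) := by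
  have hmb : IsBddMeasurable m := ⟨hm.measurable, _, fun y => by
    rw [abs_of_nonneg (hm.nonneg y)]; exact density_le hC y⟩
  refine (tendsto_integral_approximateIdentity hK.integrable hK.integral_eq_one hmb hx hpos
    hh).congr fun n => ?_
  rw [hm.integral_eq, finrank_state]
  refine integral_congr_ae (Eventually.of_forall fun y => ?_)
  simp [applyP, smoothedPoint, mul_comm]

theorem tendsto_integral_smoothedTriangle (hp : IsTransitionDensity P p)
    (hm : IsLebesgueDensity μ m) (hC : densityBound m p < ⊤) (hK : IsSmoothingKernel K₀)
    (hpos : ∀ n, 0 < h n) (hh : Tendsto h atTop (𝓝 0)) {x x₀ x₁ : State d}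
    (hx : ContinuousAt (fun y : State d × State d × State d => m y.1 * p y.1 y.2.1 y.2.2)
      (x, x₀, x₁)) :
    Tendsto (fun n => ∫ y, applyP P (smoothedTriangle K₀ (h n) x x₀ x₁) y ∂μ) atTop
      (𝓝 (m x * p x x₀ x₁)) := by
  have hGb : IsBddMeasurable fun y : State d × State d × State d =>
      m y.1 * p y.1 y.2.1 y.2.2 := by
    refine ⟨(hm.measurable.comp measurable_fst).mul hp.measurable,
      (densityBound m p).toReal * (densityBound m p).toReal, fun y => ?_⟩
    rw [abs_of_nonneg (mul_nonneg (hm.nonneg _) (hp.nonneg _ _ _))]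
    exact mul_le_mul (density_le hC _) (transitionDensity_le hC _ _ _) (hp.nonneg _ _ _)
      ENNReal.toReal_nonneg
  have haar₂ : (volume : Measure (State d × State d)).IsAddHaarMeasure :=
    Measure.prod.instIsAddHaarMeasure _ _
  have haar₃ : (volume : Measure (State d × State d × State d)).IsAddHaarMeasure :=
    Measure.prod.instIsAddHaarMeasure _ _
  have hT : Integrable fun y : State d × State d × State d => K₀ y.1 * (K₀ y.2.1 * K₀ y.2.2) :=
    hK.integrable.mul_prod (hK.integrable.mul_prod hK.integrable)
  have hT1 : ∫ y : State d × State d × State d, K₀ y.1 * (K₀ y.2.1 * K₀ y.2.2) = 1 := by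
    rw [Measure.volume_eq_prod,
      integral_prod_mul K₀ (fun z : State d × State d => K₀ z.1 * K₀ z.2),
      Measure.volume_eq_prod, integral_prod_mul, hK.integral_eq_one]
    norm_num
  have e : ∀ n (y : State d × State d × State d), smoothedTriangle K₀ (h n) x x₀ x₁ y =
      (h n ^ (3 * d))⁻¹ * (K₀ ((h n)⁻¹ • ((x, x₀, x₁) - y)).1 *
        (K₀ ((h n)⁻¹ • ((x, x₀, x₁) - y)).2.1 * K₀ ((h n)⁻¹ • ((x, x₀, x₁) - y)).2.2)) := by
    intro n y
    simp only [smoothedTriangle, tensorKernel, mul_assoc]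
    rfl
  refine (tendsto_integral_approximateIdentity hT hT1 hGb hx hpos hh).congr fun n => ?_
  have hi : Integrable (smoothedTriangle K₀ (h n) x x₀ x₁) := by
    rw [funext (e n)]
    exact (integrable_comp_inv_smul_sub hT (hpos n) (x, x₀, x₁)).const_mul _
  rw [integral_applyP hp hm hC hi, finrank_state_triple]
  simp only [e]

end Estimators

/-! ### The bandwidth -/

section Bandwidth

variable {γ : ℝ} {h : ℕ → ℝ}

theorem bandwidth_eq_pow (hh : ∀ n : ℕ, h n = (2 : ℝ) ^ (-((n : ℝ) * γ))) (n : ℕ) :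
    h n = ((2 : ℝ) ^ (-γ)) ^ n := by
  rw [hh, ← Real.rpow_natCast, ← Real.rpow_mul zero_le_two]
  ring_nf

/-- The condition `3 d γ < 1` on the bandwidth makes `n 2⁻ⁿ h⁻³ᵈ` vanish. -/
theorem tendsto_bandwidth (hd : 1 ≤ d) (hγ : γ ∈ Set.Ioo (0 : ℝ) (1 / (3 * (d : ℝ))))
    (hh : ∀ n : ℕ, h n = (2 : ℝ) ^ (-((n : ℝ) * γ))) :
    Tendsto (fun n : ℕ => n * ((2 ^ n : ℝ)⁻¹ * (h n ^ (3 * d))⁻¹)) atTop (𝓝 0) := by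
  have hd0 : (0 : ℝ) < 3 * d := by positivity
  have h3 : 3 * (d : ℝ) * γ < 1 := by
    have := (lt_div_iff₀ hd0).1 hγ.2
    linarith
  have hr : (2 : ℝ)⁻¹ * (((2 : ℝ) ^ (-γ)) ^ (3 * d))⁻¹ < 1 := by
    rw [← Real.rpow_natCast, ← Real.rpow_mul zero_le_two, ← Real.rpow_neg zero_le_two,
      inv_mul_lt_iff₀ two_pos, mul_one]
    refine (Real.rpow_lt_rpow_of_exponent_lt one_lt_two (z := 1) ?_).trans_eq (Real.rpow_one 2)
    push_cast
    linarith
  refine (tendsto_self_mul_const_pow_of_lt_one (by positivity) hr).congr fun n => ?_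
  rw [bandwidth_eq_pow hh, mul_pow, inv_pow, inv_pow, ← pow_mul, ← pow_mul, mul_comm (3 * d) n]

end Bandwidth

end BMC

/-! ### Convergence of the quotient estimator -/

theorem mainTheorem3 {d : ℕ} (hd : 1 ≤ d)
    {Ω : Type*} [MeasurableSpace Ω] (Pr : Measure Ω) [IsProbabilityMeasure Pr]
    (ν : Measure (BMC.State d)) [IsProbabilityMeasure ν]
    (P : Kernel (BMC.State d) (BMC.State d × BMC.State d)) [IsMarkovKernel P]
    (X : BMC.Node → Ω → BMC.State d) (hX : BMC.IsBMC Pr ν P X)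
    (F : Submodule ℝ (BMC.State d → ℝ)) (hF : BMC.StructuralAssumption P ν F)
    (μ : Measure (BMC.State d)) [IsProbabilityMeasure μ]
    (V : BMC.State d → ℝ) (α M : ℝ) (hErg : BMC.ErgodicAssumption P F μ V α M)
    (p : BMC.State d → BMC.State d → BMC.State d → ℝ) (hp : BMC.IsTransitionDensity P p)
    (m : BMC.State d → ℝ) (hm : BMC.IsLebesgueDensity μ m)
    (hC : BMC.densityBound m p < ⊤)
    (K₀ : BMC.State d → ℝ) (hK : BMC.IsSmoothingKernel K₀)
    (γ : ℝ) (hγ : γ ∈ Set.Ioo (0 : ℝ) (1 / (3 * (d : ℝ))))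
    (hαγ : 2 * α ^ 2 < (2 : ℝ) ^ (3 * (d : ℝ) * γ))
    (h : ℕ → ℝ) (hh : ∀ n : ℕ, h n = (2 : ℝ) ^ (-((n : ℝ) * γ)))
    (x x₀ x₁ : BMC.State d) (hx : m x ≠ 0)
    (hm_cont : ContinuousAt m x)
    (hmp_cont : ContinuousAt
      (fun y : BMC.State d × BMC.State d × BMC.State d => m y.1 * p y.1 y.2.1 y.2.2)
      (x, x₀, x₁)) :
    TendstoInMeasure Pr
        (fun n ω => BMC.transitionHat X K₀ (BMC.gen n) (h n) x x₀ x₁ ω) atTop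
        (fun _ => p x x₀ x₁) ∧
      TendstoInMeasure Pr
        (fun n ω => BMC.transitionHat X K₀ (BMC.tree n) (h n) x x₀ x₁ ω) atTop
        (fun _ => p x x₀ x₁) := by
  have hpow := BMC.bandwidth_eq_pow hh
  have hpos : ∀ n, 0 < h n := fun n => by rw [hpow]; positivity
  have hγ1 : (2 : ℝ) ^ (-γ) < 1 := Real.rpow_lt_one_of_one_lt_of_neg one_lt_two (neg_lt_zero.2 hγ.1)
  have hle1 : ∀ n, h n ≤ 1 := fun n => by
    rw [hpow]; exact pow_le_one₀ (by positivity) hγ1.le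
  have hh0 : Tendsto h atTop (𝓝 0) :=
    (tendsto_pow_atTop_nhds_zero_of_lt_one (by positivity) hγ1).congr fun n => (hpow n).symm
  have hH1 : ∀ n, 1 ≤ (h n ^ (3 * d))⁻¹ := fun n =>
    (one_le_inv₀ (pow_pos (hpos n) _)).2 (pow_le_one₀ (hpos n).le (hle1 n))
  have hHlim := BMC.tendsto_bandwidth hd hγ hh
  obtain ⟨b, hb⟩ := hK.bounded
  have hb0 : 0 ≤ b := (abs_nonneg _).trans (hb 0)
  set B := (BMC.densityBound m p).toReal with hB
  have hB0 : 0 ≤ B := ENNReal.toReal_nonneg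
  set L := ∫ y, |K₀ y| with hL
  have hL0 : 0 ≤ L := integral_nonneg fun _ => abs_nonneg _
  have hpoint := hX.tendstoInMeasure_avg hF hErg (C := b + B * L + 1)
    (f := fun n => BMC.smoothedPoint K₀ (h n) x)
    (fun n => BMC.measurable_smoothedPoint hK (h n) x) (by positivity) hH1
    (fun n y => (BMC.abs_smoothedPoint_le hb (hpos n) (hle1 n) x y).trans
      (mul_le_mul_of_nonneg_right (by linarith [mul_nonneg hB0 hL0])
        (zero_le_one.trans (hH1 n))))
    (fun n y => by
      rw [BMC.applyP_abs_smoothedPoint K₀ (hpos n)]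
      exact (BMC.applyQ_smoothed_le hp hC hK (hpos n) x y).trans (by linarith))
    hHlim (BMC.tendsto_integral_smoothedPoint hm hC hK hpos hh0 hm_cont)
  have htriangle := hX.tendstoInMeasure_avg hF hErg (C := b ^ 3 + B * L ^ 2 * (B * L) + 1)
    (f := fun n => BMC.smoothedTriangle K₀ (h n) x x₀ x₁)
    (fun n => BMC.measurable_smoothedTriangle hK (h n) x x₀ x₁) (by positivity) hH1
    (fun n y => (BMC.abs_smoothedTriangle_le hb (hpos n) x x₀ x₁ y).trans
      (mul_le_mul_of_nonneg_right
        (by linarith [mul_nonneg (mul_nonneg hB0 (sq_nonneg L)) (mul_nonneg hB0 hL0)])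
        (zero_le_one.trans (hH1 n))))
    (fun n y => by
      have hf : BMC.IsBddMeasurable (BMC.smoothedTriangle K₀ (h n) x x₀ x₁) :=
        ⟨BMC.measurable_smoothedTriangle hK (h n) x x₀ x₁, _,
          BMC.abs_smoothedTriangle_le hb (hpos n) x x₀ x₁⟩
      have hφ : BMC.IsBddMeasurable fun y => (h n ^ d)⁻¹ * |K₀ ((h n)⁻¹ • (x - y))| :=
        ((BMC.IsBddMeasurable.mk hK.measurable ⟨b, hb⟩).abs.comp (by fun_prop)).const_mul _
      have h1 := BMC.applyQ_mono (P := P) (x := y) (hf.abs.applyP.integrable _)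
        ((hφ.const_mul (B * L ^ 2)).integrable _)
        (BMC.applyP_abs_smoothedTriangle_le hp hC hK (hpos n) x x₀ x₁)
      rw [BMC.applyQ_const_mul] at h1
      have h2 := mul_le_mul_of_nonneg_left (BMC.applyQ_smoothed_le hp hC hK (hpos n) x y)
        (mul_nonneg hB0 (sq_nonneg L))
      linarith [pow_nonneg hb0 3])
    hHlim (BMC.tendsto_integral_smoothedTriangle hp hm hC hK hpos hh0 hmp_cont)
  have hquot : p x x₀ x₁ = m x * p x x₀ x₁ / m x := (mul_div_cancel_left₀ _ hx).symm
  simp only [BMC.transitionHat, BMC.muHat_eq X K₀ _ (hpos _),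
    BMC.muTriangleHat_eq X K₀ _ (hpos _)]
  rw [hquot]
  exact ⟨BMC.tendstoInMeasure_div_const htriangle.1 hpoint.1 hx,
    BMC.tendstoInMeasure_div_const htriangle.2 hpoint.2 hx⟩
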